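/- **Proposition.** Let $(M,g)$ be a smooth Riemannian manifold of dimension $n\ge 3$ and let $T_{ijk}$ be a smooth tensor field on $M$ (the structure tensor) that is symmetric and trace-free in its first two indices, $T_{jik}=T_{ijk}$ and $g^{ij}T_{ijk}=0$. A comma denotes the Levi-Civita covariant derivative, indices are raised with $g$, the curvature is normalised by $V_{,ijk}-V_{,ikj}=R^m{}_{ijk}V_{,m}$ (so that $R_{ijkl}=\kappa(g_{ik}g_{jl}-g_{il}g_{jk})$ on a space of constant sectional curvature $\kappa$), $R_{ij}=R^a{}_{iaj}$ is the Ricci tensor and $W_{ijkl}$ the Weyl tensor, i.e. the completely trace-free part of $R_{ijkl}$. Put $$t_j=T_{ij}{}^i,\qquad Q_{ijkm}=T_{ijm,k}+T_{ij}{}^{l}T_{lkm}-R_{ijkm},\qquad q_{jm}=g^{ik}Q_{ijkm},$$ let $\mathring T_{ijk}$ be the trace-free part of the total symmetrisation $\frac16\sum_{\pi\in S_3}T_{\pi(i)\pi(j)\pi(k)}$, let $\bar t_i=\frac{n}{(n+2)(n-1)}T_{ij}{}^{j}$, and $$Z_{ij}=\mathring T_i{}^{ab}\mathring T_{jab}-(n-2)\bigl(\mathring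 T_{ij}{}^a\bar t_a+\bar t_i\bar t_j\bigr)-R_{ij}.$$ The integrability conditions for the prolongation of a superintegrable potential, i.e. of the system $V_{,ij}=T_{ij}{}^mV_{,m}+\frac1n g_{ij}\Delta V$, $\frac{n-1}{n}(\Delta V)_{,k}=q_k{}^mV_{,m}+\frac1n t_k\Delta V$, are the three equations * (I) $T_{ijk}+\frac1{n-1}g_{ij}t_k$ is symmetric in $(j,k)$; * (II) $Q_{ijkl}+\frac1{n-1}g_{ij}q_{kl}$ is symmetric in $(j,k)$; * (III) $q_{kp,l}+T_{mlp}\,q_k{}^m+\frac1{n-1}t_kq_{lp}$ is symmetric in $(k,l)$. The conditions (I), (II), (III) hold on $M$ if and only if the following three conditions hold on $M$: 1. the completely trace-free part of $A_{ijk}:=S_{ijk}-S_{ikj}$, with $S_{ijk}=T_{ijk}+T_{jik}$, vanishes; 2. $\frac18 N^\circ_{ijkl}=-W_{ijkl}$, where $N^\circ$ is the completely trace-free part of the tensor $N$ obtained from $T^a{}_{ik}T_{ajl}$ by first symmetrising in $(i,k)$ and in $(j,l)$ and then antisymmetrising in $(i,j)$ and in $(k,l)$ (sums over permutations, without normalising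 factors); 3. the tensor obtained from $T_{ijk,l}+\frac{2}{n-2}g_{ik}Z_{jl}$ by first antisymmetrising in $(k,l)$ and then symmetrising in $(i,j,k)$ vanishes. Moreover, the third condition (III) is redundant: (I) and (II) together imply (III). -/

import Mathlib

open Manifold Bundle
open scoped ContDiff

noncomputable section

namespace SIC

/-! ### Tensor algebra in components

Covariant tensors at a point are arrays of components; `G` is the matrix `g_{ij}` of the metric and
indices are raised with its inverse `G⁻¹ = (g^{ij})`. -/

/-- Components of a covariant tensor with two indices. -/
abbrev Tensor2 (n : ℕ) := Fin n → Fin n → ℝ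

/-- Components of a covariant tensor with three indices. -/
abbrev Tensor3 (n : ℕ) := Fin n → Fin n → Fin n → ℝ

/-- Components of a covariant tensor with four indices. -/
abbrev Tensor4 (n : ℕ) := Fin n → Fin n → Fin n → Fin n → ℝ

variable {n : ℕ}

/-- The symmetriser with the one-row Young tableau `(ijk)`, without normalisation. -/
def youngSym (A : Tensor3 n) : Tensor3 n := fun i j k =>
  A i j k + A i k j + A k i j + A k j i + A j k i + A j i k

/-- The adjoint hook projector of the Young tableau with first row `(j i)` and second row `(k)`:
first symmetrise in `(i,j)`, then antisymmetrise in `(j,k)`, without normalisation. -/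
def youngHookAdjoint (A : Tensor3 n) : Tensor3 n := fun i j k =>
  let S : Tensor3 n := fun i j k => A i j k + A j i k
  S i j k - S i k j

/-- The adjoint projector of the Young tableau with rows `(i k)` and `(j l)`: first symmetrise in
`(i,k)` and in `(j,l)`, then antisymmetrise in `(i,j)` and in `(k,l)`, without normalisation. -/
def youngRiemannAdjoint (A : Tensor4 n) : Tensor4 n := fun i j k l =>
  let S : Tensor4 n := fun i j k l => A i j k l + A k j i l + A i l k j + A k l i j
  S i j k l - S j i k l - S i j l k + S j i l k

/-- The hook projector of the Young tableau with first row `(k j i)` and second row `(l)`: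
first antisymmetrise in `(k,l)`, then symmetrise in `(i,j,k)`, without normalisation. -/
def youngHook (A : Tensor4 n) : Tensor4 n := fun i j k l =>
  let D : Tensor4 n := fun i j k l => A i j k l - A i j l k
  D i j k l + D i k j l + D k i j l + D k j i l + D j k i l + D j i k l

/-- The completely trace-free part of a covariant 3-tensor `A` (for `2 ≤ n`):
`A` minus `g_{ij} a_k + g_{ik} b_j + g_{jk} c_i`, with `a`, `b`, `c` the combinations of the three
traces of `A` for which all traces of the difference vanish. -/
def traceFree3 (G : Matrix (Fin n) (Fin n) ℝ) (A : Tensor3 n) : Tensor3 n := fun i j k =>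
  let u : Fin n → ℝ := fun c => ∑ a, ∑ b, G⁻¹ a b * A a b c
  let v : Fin n → ℝ := fun c => ∑ a, ∑ b, G⁻¹ a b * A a c b
  let w : Fin n → ℝ := fun c => ∑ a, ∑ b, G⁻¹ a b * A c a b
  let s : Fin n → ℝ := fun c => (u c + v c + w c) / ((n : ℝ) + 2)
  A i j k - (G i j * (u k - s k) + G i k * (v j - s j) + G j k * (w i - s i)) / ((n : ℝ) - 1)

/-- The Ricci contraction `A_{ik} = g^{ab} A_{aibk}` of a tensor with curvature symmetries. -/
def ricciContraction (G : Matrix (Fin n) (Fin n) ℝ) (A : Tensor4 n) : Tensor2 n := fun i k =>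
  ∑ a, ∑ b, G⁻¹ a b * A a i b k

/-- The completely trace-free part (Weyl part) of a covariant 4-tensor `A` with the symmetries of a
curvature tensor (for `3 ≤ n`). -/
def traceFreeRiemann (G : Matrix (Fin n) (Fin n) ℝ) (A : Tensor4 n) : Tensor4 n := fun i j k l =>
  let ρ := ricciContraction G A
  let σ : ℝ := ∑ a, ∑ b, G⁻¹ a b * ρ a b
  A i j k l
    - (ρ i k * G j l - ρ j k * G i l - ρ i l * G j k + ρ j l * G i k) / ((n : ℝ) - 2)
    + σ * (G i k * G j l - G i l * G j k) / (((n : ℝ) - 1) * ((n : ℝ) - 2))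

/-! ### Riemannian geometry in coordinates

`G` and `T` are now the component functions of the metric and of a tensor field on (an open subset
of) `ℝⁿ`. -/

/-- The coordinate space `ℝⁿ`. -/
abbrev Coord (n : ℕ) := EuclideanSpace ℝ (Fin n)

/-- The partial derivative `∂_i f` at `y`. -/
def pderiv (i : Fin n) (f : Coord n → ℝ) (y : Coord n) : ℝ :=
  fderiv ℝ f y (EuclideanSpace.single i 1)

/-- The Christoffel symbols `Γ^a_{ij}` of the Levi-Civita connection. -/
def christoffel (G : Coord n → Matrix (Fin n) (Fin n) ℝ) (y : Coord n) (a i j : Fin n) : ℝ :=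
  (1 / 2) * ∑ b, (G y)⁻¹ a b *
    (pderiv i (fun z => G z b j) y + pderiv j (fun z => G z b i) y - pderiv b (fun z => G z i j) y)

/-- The covariant derivative `B_{ij,l}` of a covariant 2-tensor. -/
def covDeriv2 (G : Coord n → Matrix (Fin n) (Fin n) ℝ) (B : Coord n → Tensor2 n) (y : Coord n) :
    Tensor3 n := fun i j l =>
  pderiv l (fun z => B z i j) y
    - ∑ a, (christoffel G y a l i * B y a j + christoffel G y a l j * B y i a)

/-- The covariant derivative `A_{ijk,l}` of a covariant 3-tensor. -/
def covDeriv3 (G : Coord n → Matrix (Fin n) (Fin n) ℝ) (A : Coord n → Tensor3 n) (y : Coord n) :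
    Tensor4 n := fun i j k l =>
  pderiv l (fun z => A z i j k) y
    - ∑ a, (christoffel G y a l i * A y a j k + christoffel G y a l j * A y i a k
        + christoffel G y a l k * A y i j a)

/-- The curvature tensor `R^m_{ijk} = ∂_j Γ^m_{ik} - ∂_k Γ^m_{ij} + Γ^m_{ja} Γ^a_{ik}
- Γ^m_{ka} Γ^a_{ij}`, so that `V_{,ijk} - V_{,ikj} = R^m_{ijk} V_{,m}`. -/
def riemannUp (G : Coord n → Matrix (Fin n) (Fin n) ℝ) (y : Coord n) (m i j k : Fin n) : ℝ :=
  pderiv j (fun z => christoffel G z m i k) y - pderiv k (fun z => christoffel G z m i j) y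
    + ∑ a, (christoffel G y m j a * christoffel G y a i k
        - christoffel G y m k a * christoffel G y a i j)

/-- The covariant curvature tensor `R_{lijk} = g_{lm} R^m_{ijk}`. On a round sphere of curvature
`κ` it is `R_{lijk} = κ (g_{lj} g_{ik} - g_{lk} g_{ij})`. -/
def riemann (G : Coord n → Matrix (Fin n) (Fin n) ℝ) (y : Coord n) : Tensor4 n := fun l i j k =>
  ∑ m, G y l m * riemannUp G y m i j k

/-- The Ricci tensor `R_{ij} = R^a_{iaj}`. -/
def ricci (G : Coord n → Matrix (Fin n) (Fin n) ℝ) (y : Coord n) : Tensor2 n :=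
  ricciContraction (G y) (riemann G y)

/-- The Weyl tensor `W_{ijkl}`. -/
def weyl (G : Coord n → Matrix (Fin n) (Fin n) ℝ) (y : Coord n) : Tensor4 n :=
  traceFreeRiemann (G y) (riemann G y)

/-! ### Tensors built from the structure tensor -/

/-- The trace `t_j = T_{ij}^i`. -/
def tTrace (G : Coord n → Matrix (Fin n) (Fin n) ℝ) (T : Coord n → Tensor3 n) (y : Coord n)
    (j : Fin n) : ℝ :=
  ∑ i, ∑ a, (G y)⁻¹ i a * T y i j a

/-- The tensor `Q_{ijkm} = T_{ijm,k} + T_{ij}^a T_{akm} - R_{ijkm}`. -/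
def tensorQ (G : Coord n → Matrix (Fin n) (Fin n) ℝ) (T : Coord n → Tensor3 n) (y : Coord n) :
    Tensor4 n := fun i j k m =>
  covDeriv3 G T y i j m k + (∑ a, ∑ b, (G y)⁻¹ a b * T y i j a * T y b k m) - riemann G y i j k m

/-- The tensor `q_{jm} = Q_{ij}^i_m`. -/
def tensorq (G : Coord n → Matrix (Fin n) (Fin n) ℝ) (T : Coord n → Tensor3 n) (y : Coord n) :
    Tensor2 n := fun j m =>
  ∑ i, ∑ a, (G y)⁻¹ i a * tensorQ G T y i j a m

/-- The trace-free part of the totally symmetric part of the structure tensor. -/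
def tRing (G : Coord n → Matrix (Fin n) (Fin n) ℝ) (T : Coord n → Tensor3 n) (y : Coord n) :
    Tensor3 n :=
  traceFree3 (G y) (fun i j k => (1 / 6) * youngSym (T y) i j k)

/-- The rescaled trace `n / ((n+2)(n-1)) T_{ij}^j` of the structure tensor. -/
def tBar (G : Coord n → Matrix (Fin n) (Fin n) ℝ) (T : Coord n → Tensor3 n) (y : Coord n)
    (i : Fin n) : ℝ :=
  (n : ℝ) / (((n : ℝ) + 2) * ((n : ℝ) - 1)) * ∑ j, ∑ a, (G y)⁻¹ j a * T y i j a

/-- The tensor `Z_{ij}`: with `S = tRing` and `s = tBar`,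
`Z_{ij} = S_i^{ab} S_{jab} - (n-2) (S_{ij}^a s_a + s_i s_j) - R_{ij}`. -/
def tensorZ (G : Coord n → Matrix (Fin n) (Fin n) ℝ) (T : Coord n → Tensor3 n) (y : Coord n) :
    Tensor2 n := fun i j =>
  (∑ a, ∑ b, ∑ c, ∑ d, (G y)⁻¹ a c * (G y)⁻¹ b d * tRing G T y i c d * tRing G T y j a b)
    - ((n : ℝ) - 2) *
      ((∑ a, ∑ b, (G y)⁻¹ a b * tRing G T y i j b * tBar G T y a) + tBar G T y i * tBar G T y j)
    - ricci G y i j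

/-! ### The integrability conditions, in coordinates at one point -/

/-- `T_{ijk}` is symmetric and trace-free in its first two indices. -/
def StructureSymmetriesAt (G : Coord n → Matrix (Fin n) (Fin n) ℝ) (T : Coord n → Tensor3 n)
    (y : Coord n) : Prop :=
  (∀ i j k, T y j i k = T y i j k) ∧ ∀ k, ∑ i, ∑ j, (G y)⁻¹ i j * T y i j k = 0

/-- First integrability condition: `T_{ijk} + g_{ij} t_k / (n-1)` is symmetric in `(j,k)`. -/
def LinearConditionAt (G : Coord n → Matrix (Fin n) (Fin n) ℝ) (T : Coord n → Tensor3 n)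
    (y : Coord n) : Prop :=
  ∀ i j k,
    (T y i j k + 1 / ((n : ℝ) - 1) * G y i j * tTrace G T y k)
      - (T y i k j + 1 / ((n : ℝ) - 1) * G y i k * tTrace G T y j) = 0

/-- Second integrability condition: `Q_{ijkl} + g_{ij} q_{kl} / (n-1)` is symmetric in `(j,k)`. -/
def QuadraticConditionAt (G : Coord n → Matrix (Fin n) (Fin n) ℝ) (T : Coord n → Tensor3 n)
    (y : Coord n) : Prop :=
  ∀ i j k l,
    (tensorQ G T y i j k l + 1 / ((n : ℝ) - 1) * G y i j * tensorq G T y k l)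
      - (tensorQ G T y i k j l + 1 / ((n : ℝ) - 1) * G y i k * tensorq G T y j l) = 0

/-- The expression `q_{kp,l} + T_{mlp} q_k^m + t_k q_{lp} / (n-1)` of the third condition. -/
def cubicTerm (G : Coord n → Matrix (Fin n) (Fin n) ℝ) (T : Coord n → Tensor3 n)
    (y : Coord n) : Tensor3 n := fun k l p =>
  covDeriv2 G (tensorq G T) y k p l
    + (∑ m, ∑ b, (G y)⁻¹ m b * T y m l p * tensorq G T y k b)
    + 1 / ((n : ℝ) - 1) * tTrace G T y k * tensorq G T y l p

/-- Third integrability condition: the above expression is symmetric in `(k,l)`. -/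
def CubicConditionAt (G : Coord n → Matrix (Fin n) (Fin n) ℝ) (T : Coord n → Tensor3 n)
    (y : Coord n) : Prop :=
  ∀ k l p, cubicTerm G T y k l p - cubicTerm G T y l k p = 0

/-- The trace-free part of the hook symmetric part of `T` vanishes. -/
def HookConditionAt (G : Coord n → Matrix (Fin n) (Fin n) ℝ) (T : Coord n → Tensor3 n)
    (y : Coord n) : Prop :=
  ∀ i j k, traceFree3 (G y) (youngHookAdjoint (T y)) i j k = 0

/-- The trace-free Riemann-symmetrised square of `T`, divided by `8`, is `-W`, for the curvature
convention `V_{,ijk} - V_{,ikj} = R^m_{ijk} V_{,m}`. -/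
def WeylConditionAt (G : Coord n → Matrix (Fin n) (Fin n) ℝ) (T : Coord n → Tensor3 n)
    (y : Coord n) : Prop :=
  ∀ i j k l,
    (1 / 8) * traceFreeRiemann (G y) (youngRiemannAdjoint
      (fun i j k l => ∑ a, ∑ b, (G y)⁻¹ a b * T y b i k * T y a j l)) i j k l
      = - weyl G y i j k l

/-- The hook symmetriser annihilates `T_{ijk,l} + 2/(n-2) g_{ik} Z_{jl}`. -/
def DifferentialConditionAt (G : Coord n → Matrix (Fin n) (Fin n) ℝ) (T : Coord n → Tensor3 n)
    (y : Coord n) : Prop :=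
  ∀ i j k l, youngHook (fun i j k l =>
    covDeriv3 G T y i j k l + 2 / ((n : ℝ) - 2) * G y i k * tensorZ G T y j l) i j k l = 0

/-! ### Tensor fields on a manifold -/

section Manifold

variable (n)
variable (M : Type*) [TopologicalSpace M] [ChartedSpace (Coord n) M]

/-- A field of covariant 3-tensors on `M`. -/
abbrev TensorField3 := (x : M) →
  TangentSpace (𝓡 n) x →L[ℝ] TangentSpace (𝓡 n) x →L[ℝ] TangentSpace (𝓡 n) x →L[ℝ] ℝ

variable {n M}

/-- The `i`-th coordinate vector of the chart `e` at the point with coordinates `y`. -/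
def coordVec (e : OpenPartialHomeomorph M (Coord n)) (y : Coord n) (i : Fin n) :
    TangentSpace (𝓡 n) (e.symm y) :=
  mfderiv (𝓡 n) (𝓡 n) e.symm y (EuclideanSpace.single i 1 : Coord n)

/-- The components `g_{ij}` of the metric in the chart `e`. -/
def metricComp [IsManifold (𝓡 n) ∞ M]
    (g : ContMDiffRiemannianMetric (𝓡 n) ∞ (Coord n) (fun x : M => TangentSpace (𝓡 n) x))
    (e : OpenPartialHomeomorph M (Coord n)) (y : Coord n) : Matrix (Fin n) (Fin n) ℝ :=
  Matrix.of fun i j => g.inner (e.symm y) (coordVec e y i) (coordVec e y j)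

/-- The components `T_{ijk}` of a tensor field in the chart `e`. -/
def tensorComp (T : TensorField3 n M) (e : OpenPartialHomeomorph M (Coord n)) (y : Coord n) :
    Tensor3 n := fun i j k =>
  T (e.symm y) (coordVec e y i) (coordVec e y j) (coordVec e y k)

/-- Smoothness of a field of covariant 3-tensors: its components are smooth in every smooth chart. -/
def IsSmoothTensorField3 [IsManifold (𝓡 n) ∞ M] (T : TensorField3 n M) : Prop :=
  ∀ e ∈ IsManifold.maximalAtlas (𝓡 n) ∞ M, ∀ i j k,
    ContDiffOn ℝ ∞ (fun y => tensorComp T e y i j k) e.target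

/-- The tensor equation `P`, written in components, holds on all of `M`: it holds in every smooth
chart, at every point of the chart. -/
def HoldsOn [IsManifold (𝓡 n) ∞ M]
    (P : (Coord n → Matrix (Fin n) (Fin n) ℝ) → (Coord n → Tensor3 n) → Coord n → Prop)
    (g : ContMDiffRiemannianMetric (𝓡 n) ∞ (Coord n) (fun x : M => TangentSpace (𝓡 n) x))
    (T : TensorField3 n M) : Prop :=
  ∀ e ∈ IsManifold.maximalAtlas (𝓡 n) ∞ M, ∀ y ∈ e.target, P (metricComp g e) (tensorComp T e) y

end Manifold

end SIC

end

/-!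
All conditions are tensor equations, so everything happens in one chart, with `G = (g_{ij})` and
`G⁻¹ = (g^{ij})`.

*The first condition.* As `T` is symmetric and trace-free in its first two indices, the
antisymmetric part in `(j,k)` of `T_{ijk} + g_{ij} t_k / (n-1)` is, up to a factor, the trace-free
part of the hook projection of `T` (`linearConditionAt_iff`). It vanishes if and only if `T` is
assembled from a harmonic (totally symmetric and trace-free) tensor `S` and a covector `s`,
`T_{ijk} = S_{ijk} + g_{ik} s_j + g_{jk} s_i - (2/n) g_{ij} s_k`, namely from `S = T̊` and
`s = t̄` (`exists_assemble`, `tRing_eq`). The metric being parallel, `∇T` is assembled in the same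
way from `X = ∇S` and `P = ∇s` (`covDeriv3_assemble`).

*The second condition.* Inserting this into the second condition leaves an equation in `X`, in a
tensor `K` with curvature symmetries (the curvature plus the antisymmetrised square of `S`) and in
trace terms. Contracting shows that `P` is symmetric and that the trace terms are determined, up
to a multiple of the metric, by the divergence of `X` and the Ricci contraction of `K`. The rest
decomposes under the exchange of the two outer indices: the symmetric part is the trace-free part
of the antisymmetrisation of `X`, the antisymmetric part is the Weyl part of `K`
(`quadraticForm_eq_zero_iff`). The last is the Weyl condition, since the trace terms of `T` change
its Riemann-symmetrised square by a Kulkarni–Nomizu product with the metric only. The trace terms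
together with the hook part are the differential condition (`youngHook_eq_zero_iff`).

*The third condition.* Put `A_j = g⁻¹ T_j - Γ_j`. The second condition says that the connection
`∂_j - A_j` on a trivial bundle of rank `n` has the pure trace curvature
`(F_{jk})^i_m = -(δ^i_j q_{km} - δ^i_k q_{jm}) / (n-1)` (`curv_prolongMat`). As `n ≥ 3`, for given
`k ≠ l` there is an index `j` different from both; row `j` of the Bianchi identity for the indices
`j, k, l` is the third condition, once the entries of the `A`s in that row are rewritten with the
first condition (`cubicConditionAt`).
-/

noncomputable section

namespace SIC

/-! ### Contraction with the inverse metric -/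

section Algebra

variable {n : ℕ} {G H : Tensor2 n}

/-- The contraction `h^{ab} f_{ab}` with the components `h^{ab}` of an inverse metric. -/
def contr (H : Tensor2 n) (f : Tensor2 n) : ℝ := ∑ a, ∑ b, H a b * f a b

/-- The contraction `h^{ab} x_a y_b` of two covectors. -/
def dot (H : Tensor2 n) (x y : Fin n → ℝ) : ℝ := ∑ a, ∑ b, H a b * x a * y b

/-- `G` and `H` are the components of a pseudo-Riemannian metric at a point and of its inverse.
Positivity plays no part in the tensor algebra. -/
structure IsMetric (G H : Tensor2 n) : Prop where
  symm : ∀ i j, G i j = G j i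
  inv_symm : ∀ i j, H i j = H j i
  sum_inv_mul : ∀ i j, ∑ a, H i a * G a j = if i = j then 1 else 0

lemma contr_add (f h : Tensor2 n) :
    contr H (fun a b => f a b + h a b) = contr H f + contr H h := by
  simp [contr, mul_add, Finset.sum_add_distrib]

lemma contr_mul_const (f : Tensor2 n) (c : ℝ) :
    contr H (fun a b => f a b * c) = contr H f * c := by
  simp [contr, Finset.sum_mul, mul_assoc]

lemma contr_const_mul (f : Tensor2 n) (c : ℝ) :
    contr H (fun a b => c * f a b) = c * contr H f := by
  simp_rw [mul_comm c, contr_mul_const]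

lemma contr_div_const (f : Tensor2 n) (c : ℝ) :
    contr H (fun a b => f a b / c) = contr H f / c := by
  simp_rw [div_eq_mul_inv, contr_mul_const]

lemma contr_neg (f : Tensor2 n) : contr H (fun a b => - f a b) = - contr H f := by
  simp [contr]

lemma contr_sub (f h : Tensor2 n) :
    contr H (fun a b => f a b - h a b) = contr H f - contr H h := by
  simp [contr, mul_sub, Finset.sum_sub_distrib]

lemma contr_comm (f : Tensor4 n) : contr H (fun a b => contr H fun c d => f a b c d)
    = contr H fun c d => contr H fun a b => f a b c d := by
  simp only [contr, Finset.mul_sum]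
  calc _ = ∑ a, ∑ c, ∑ b, ∑ d, H a b * (H c d * f a b c d) :=
        Finset.sum_congr rfl fun _ _ => Finset.sum_comm
    _ = ∑ c, ∑ a, ∑ d, ∑ b, H a b * (H c d * f a b c d) := by
        rw [Finset.sum_comm]
        exact Finset.sum_congr rfl fun _ _ => Finset.sum_congr rfl fun _ _ => Finset.sum_comm
    _ = _ := Finset.sum_congr rfl fun _ _ => by
        rw [Finset.sum_comm]
        exact Finset.sum_congr rfl fun _ _ => Finset.sum_congr rfl fun _ _ =>
          Finset.sum_congr rfl fun _ _ => by ring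

lemma contr_zero : contr H (fun _ _ => 0) = 0 := by simp [contr]

lemma contr_eq_zero {f : Tensor2 n} (h : ∀ a b, f a b = 0) : contr H (fun a b => f a b) = 0 := by
  simp [contr, h]

lemma IsMetric.contr_swap (hG : IsMetric G H) (f : Tensor2 n) :
    contr H (fun a b => f b a) = contr H f := by
  unfold contr
  rw [Finset.sum_comm]
  exact Finset.sum_congr rfl fun i _ => Finset.sum_congr rfl fun j _ => by rw [hG.inv_symm]

lemma IsMetric.contr_left (hG : IsMetric G H) (x : Fin n → ℝ) (i : Fin n) :
    contr H (fun a b => G a i * x b) = x i := by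
  unfold contr
  rw [Finset.sum_comm]
  have : ∀ b, ∑ a, H a b * (G a i * x b) = if b = i then x b else 0 := fun b => by
    simp_rw [← mul_assoc, hG.inv_symm _ b]
    rw [← Finset.sum_mul, hG.sum_inv_mul]
    split_ifs <;> simp
  simp [this]

lemma IsMetric.contr_left' (hG : IsMetric G H) (x : Fin n → ℝ) (i : Fin n) :
    contr H (fun a b => G i a * x b) = x i := by
  simpa only [hG.symm i] using hG.contr_left x i

lemma IsMetric.contr_right (hG : IsMetric G H) (x : Fin n → ℝ) (i : Fin n) :
    contr H (fun a b => G b i * x a) = x i := by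
  rw [← hG.contr_left x i]
  exact hG.contr_swap fun a b => G a i * x b

lemma IsMetric.contr_right' (hG : IsMetric G H) (x : Fin n → ℝ) (i : Fin n) :
    contr H (fun a b => G i b * x a) = x i := by
  simpa only [hG.symm i] using hG.contr_right x i

lemma IsMetric.contr_self (hG : IsMetric G H) : contr H (fun a b => G a b) = n := by
  have h : ∀ a, ∑ b, H a b * G a b = 1 := fun a => by
    simpa [hG.symm a] using hG.sum_inv_mul a a
  simp [contr, h]

lemma dot_eq_contr (x y : Fin n → ℝ) : dot H x y = contr H (fun a b => x a * y b) := by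
  simp [dot, contr, mul_assoc]

lemma IsMetric.dot_comm (hG : IsMetric G H) (x y : Fin n → ℝ) : dot H x y = dot H y x := by
  rw [dot_eq_contr, dot_eq_contr, ← hG.contr_swap]
  simp_rw [mul_comm]

lemma dot_add_left (x y z : Fin n → ℝ) :
    dot H (fun a => x a + y a) z = dot H x z + dot H y z := by
  simp [dot, mul_add, add_mul, Finset.sum_add_distrib]

lemma dot_sub_left (x y z : Fin n → ℝ) :
    dot H (fun a => x a - y a) z = dot H x z - dot H y z := by
  simp [dot, mul_sub, sub_mul, Finset.sum_sub_distrib]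

lemma dot_mul_const_left (x z : Fin n → ℝ) (c : ℝ) :
    dot H (fun a => x a * c) z = dot H x z * c := by
  simp [dot, Finset.sum_mul]
  exact Finset.sum_congr rfl fun _ _ => Finset.sum_congr rfl fun _ _ => by ring

lemma dot_const_mul_left (x z : Fin n → ℝ) (c : ℝ) :
    dot H (fun a => c * x a) z = c * dot H x z := by
  simp_rw [mul_comm c, dot_mul_const_left]

lemma dot_add_right (x y z : Fin n → ℝ) :
    dot H z (fun a => x a + y a) = dot H z x + dot H z y := by
  simp [dot, mul_add, Finset.sum_add_distrib]

lemma dot_sub_right (x y z : Fin n → ℝ) :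
    dot H z (fun a => x a - y a) = dot H z x - dot H z y := by
  simp [dot, mul_sub, Finset.sum_sub_distrib]

lemma dot_mul_const_right (x z : Fin n → ℝ) (c : ℝ) :
    dot H z (fun a => x a * c) = dot H z x * c := by
  simp [dot, Finset.sum_mul, mul_assoc]

lemma dot_const_mul_right (x z : Fin n → ℝ) (c : ℝ) :
    dot H z (fun a => c * x a) = c * dot H z x := by
  simp_rw [mul_comm c, dot_mul_const_right]

lemma IsMetric.dot_left (hG : IsMetric G H) (x : Fin n → ℝ) (i : Fin n) :
    dot H (fun a => G a i) x = x i := by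
  rw [dot_eq_contr, hG.contr_left]

lemma IsMetric.dot_left' (hG : IsMetric G H) (x : Fin n → ℝ) (i : Fin n) :
    dot H (fun a => G i a) x = x i := by
  rw [dot_eq_contr, hG.contr_left']

lemma IsMetric.dot_right (hG : IsMetric G H) (x : Fin n → ℝ) (i : Fin n) :
    dot H x (fun a => G a i) = x i := by
  rw [hG.dot_comm, hG.dot_left]

/-! ### Splitting off traces -/

/-- Totally symmetric and trace-free. -/
structure IsHarmonic (H : Tensor2 n) (S : Tensor3 n) : Prop where
  symm₁₂ : ∀ i j k, S j i k = S i j k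
  symm₂₃ : ∀ i j k, S i k j = S i j k
  trace : ∀ k, contr H (fun a b => S a b k) = 0

lemma IsHarmonic.symm₁₃ {S : Tensor3 n} (h : IsHarmonic H S) (i j k : Fin n) :
    S k j i = S i j k := by
  rw [h.symm₁₂, h.symm₂₃, h.symm₁₂]

lemma IsHarmonic.rotate {S : Tensor3 n} (h : IsHarmonic H S) (i j k : Fin n) :
    S j k i = S i j k := by
  rw [h.symm₂₃, h.symm₁₂]

lemma IsHarmonic.trace₁₃ {S : Tensor3 n} (h : IsHarmonic H S) (k : Fin n) :
    contr H (fun a b => S a k b) = 0 :=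
  (congrArg (contr H) (funext₂ fun a b => h.symm₂₃ a b k)).trans (h.trace k)

lemma IsHarmonic.trace₂₃ {S : Tensor3 n} (h : IsHarmonic H S) (k : Fin n) :
    contr H (fun a b => S k a b) = 0 :=
  (congrArg (contr H) (funext₂ fun a b => h.symm₁₂ a k b)).trans (h.trace₁₃ k)

/-- The tensor with harmonic part `S` and rescaled trace `s`. It is trace-free in its first two
indices, and every structure tensor satisfying the first integrability condition has this form. -/
def assemble (G : Tensor2 n) (S : Tensor3 n) (s : Fin n → ℝ) : Tensor3 n :=
  fun i j k => S i j k + G i k * s j + G j k * s i - 2 / (n : ℝ) * (G i j * s k)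

lemma exists_assemble (hn : 3 ≤ n) (hG : IsMetric G H) {A : Tensor3 n} {t : Fin n → ℝ}
    (hsym : ∀ i j k, A j i k = A i j k) (htr : ∀ k, contr H (fun i j => A i j k) = 0)
    (hI : ∀ i j k, (A i j k + 1 / ((n : ℝ) - 1) * G i j * t k)
      - (A i k j + 1 / ((n : ℝ) - 1) * G i k * t j) = 0) :
    ∃ S, IsHarmonic H S ∧
      A = assemble G S (fun j => (n : ℝ) / (((n : ℝ) + 2) * ((n : ℝ) - 1)) * t j) := by
  have hn' : (3 : ℝ) ≤ n := by exact_mod_cast hn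
  have h0 : (n : ℝ) ≠ 0 := by linarith
  have h1 : (n : ℝ) - 1 ≠ 0 := by linarith
  have h2 : (n : ℝ) + 2 ≠ 0 := by linarith
  set s : Fin n → ℝ := fun j => (n : ℝ) / (((n : ℝ) + 2) * ((n : ℝ) - 1)) * t j with hs
  refine ⟨fun i j k => A i j k - G i k * s j - G j k * s i + 2 / (n : ℝ) * (G i j * s k),
    ⟨fun i j k => ?_, fun i j k => ?_, fun k => ?_⟩, ?_⟩
  · simp only [hsym i j k, hG.symm j i]; ring
  · have := hI i k j
    simp only [hs, hG.symm k j]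
    field_simp at this ⊢
    linear_combination ((n : ℝ) + 2) * this
  · simp only [contr_sub, contr_add, contr_const_mul, contr_mul_const, hG.contr_left,
      hG.contr_right, hG.contr_self, htr]
    field_simp
    ring
  · ext i j k; simp only [assemble]; ring

end Algebra

/-! ### Tensors with curvature symmetries -/

section Curvature

variable {n : ℕ} {G H : Tensor2 n}

/-- The algebraic symmetries of a curvature tensor. -/
structure IsCurvature (R : Tensor4 n) : Prop where
  antisymm₁₂ : ∀ i j k l, R j i k l = - R i j k l
  antisymm₃₄ : ∀ i j k l, R i j l k = - R i j k l
  bianchi : ∀ i j k l, R i j k l + R i k l j + R i l j k = 0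

lemma IsCurvature.pair_symm {R : Tensor4 n} (h : IsCurvature R) (i j k l : Fin n) :
    R k l i j = R i j k l := by
  linarith [h.bianchi i j k l, h.bianchi j k l i, h.bianchi k l i j, h.bianchi l i j k,
    h.antisymm₁₂ i j k l, h.antisymm₁₂ i k l j, h.antisymm₁₂ i l j k, h.antisymm₁₂ j k l i,
    h.antisymm₁₂ j l i k, h.antisymm₁₂ j i k l, h.antisymm₁₂ k l i j, h.antisymm₁₂ k i j l,
    h.antisymm₁₂ k j l i, h.antisymm₁₂ l i j k, h.antisymm₁₂ l j k i, h.antisymm₁₂ l k i j,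
    h.antisymm₃₄ i j k l, h.antisymm₃₄ i k l j, h.antisymm₃₄ i l j k, h.antisymm₃₄ j k l i,
    h.antisymm₃₄ j l i k, h.antisymm₃₄ j i k l, h.antisymm₃₄ k l i j, h.antisymm₃₄ k i j l,
    h.antisymm₃₄ k j l i, h.antisymm₃₄ l i j k, h.antisymm₃₄ l j k i, h.antisymm₃₄ l k i j]

/-- The Ricci contraction. -/
def ric (H : Tensor2 n) (K : Tensor4 n) : Tensor2 n := fun i k => contr H fun a b => K a i b k

/-- The Weyl part of a tensor with curvature symmetries. -/
def weylPart (G H : Tensor2 n) (K : Tensor4 n) : Tensor4 n := fun i j k l =>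
  K i j k l - (ric H K i k * G j l - ric H K j k * G i l - ric H K i l * G j k
      + ric H K j l * G i k) / ((n : ℝ) - 2)
    + contr H (ric H K) * (G i k * G j l - G i l * G j k) / (((n : ℝ) - 1) * ((n : ℝ) - 2))

lemma ric_symm (hG : IsMetric G H) {K : Tensor4 n} (hK : IsCurvature K) (i k : Fin n) :
    ric H K k i = ric H K i k := by
  unfold ric
  rw [← hG.contr_swap]
  exact congrArg (contr H) (funext₂ fun a b => hK.pair_symm a i b k)

lemma contr_curvature₁₂ (hG : IsMetric G H) {K : Tensor4 n} (hK : IsCurvature K) (i j : Fin n) :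
    contr H (fun a b => K a b i j) = 0 := by
  have h := hG.contr_swap fun a b => K a b i j
  have h' : contr H (fun a b => K b a i j) = - contr H (fun a b => K a b i j) := by
    rw [← contr_neg]
    exact congrArg (contr H) (funext₂ fun a b => hK.antisymm₁₂ a b i j)
  linarith

lemma contr_curvature₂₃ {K : Tensor4 n} (hK : IsCurvature K) (i j : Fin n) :
    contr H (fun a b => K i a b j) = - ric H K i j := by
  unfold ric
  rw [← contr_neg]
  exact congrArg (contr H) (funext₂ fun a b => hK.antisymm₁₂ a i b j)

lemma weylPart_antisymm {K : Tensor4 n} (hK : IsCurvature K) (i j k l : Fin n) :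
    weylPart G H K j i k l = - weylPart G H K i j k l := by
  simp only [weylPart, hK.antisymm₁₂ i j k l]
  ring

/-! ### The second condition for unspecified tensors -/

/-- The divergence of a tensor that is harmonic in its first three indices. -/
def divergence (H : Tensor2 n) (X : Tensor4 n) : Tensor2 n := fun i j =>
  contr H fun a b => X a i j b

/-- The left-hand side of the second integrability condition, for unspecified tensors in place of
those formed from the structure tensor. `X` plays the part of the covariant derivative of the
harmonic part of the structure tensor, `P` that of its rescaled trace, `K` has the symmetries of a
curvature tensor, and `α`, `β` collect the remaining pure-trace terms. -/
def quadraticForm (G : Tensor2 n) (X K : Tensor4 n) (P α β : Tensor2 n) : Tensor4 n :=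
  fun i j k m =>
    X i j m k - X i k m j + K i m j k + G i m * (P j k - P k j)
      + G j m * α i k - G k m * α i j + G i j * β k m - G i k * β j m

/-- The trace-free part of `X_{ijmk} - X_{ikmj}` vanishes. -/
def HookPartZero (G H : Tensor2 n) (X : Tensor4 n) : Prop := ∀ i j k m,
  X i j m k - X i k m j + (G j m * divergence H X i k - G k m * divergence H X i j
    + G i j * divergence H X k m - G i k * divergence H X j m) / (n : ℝ) = 0

/-- The pure-trace content of the second integrability condition. -/
def TracePartZero (G H : Tensor2 n) (X K : Tensor4 n) (P α : Tensor2 n) : Prop :=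
  (∀ i j, P i j = P j i) ∧ ∃ c : ℝ, ∀ i k,
    α i k = divergence H X i k / (n : ℝ) + ric H K i k / ((n : ℝ) - 2) + c * G i k

variable {X K : Tensor4 n} {P α β : Tensor2 n}

lemma divergence_symm (hX : ∀ l, IsHarmonic H fun i j k => X i j k l) (i j : Fin n) :
    divergence H X j i = divergence H X i j :=
  congrArg (contr H) (funext₂ fun a b => (hX b).symm₂₃ a i j)

lemma contr_harmonic₁₄ (X : Tensor4 n) (i j : Fin n) :
    contr H (fun a b => X a i j b) = divergence H X i j := rfl

lemma contr_harmonic₂₄ (hX : ∀ l, IsHarmonic H fun i j k => X i j k l) (i j : Fin n) :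
    contr H (fun a b => X i a j b) = divergence H X i j :=
  congrArg (contr H) (funext₂ fun a b => (hX b).symm₁₂ a i j)

lemma contr_harmonic₃₄ (hX : ∀ l, IsHarmonic H fun i j k => X i j k l) (i j : Fin n) :
    contr H (fun a b => X i j a b) = divergence H X i j :=
  (congrArg (contr H) (funext₂ fun a b => (hX b).symm₂₃ i a j)).trans (contr_harmonic₂₄ hX i j)

lemma contr_divergence (hX : ∀ l, IsHarmonic H fun i j k => X i j k l) :
    contr H (fun i j => divergence H X i j) = 0 := by
  unfold divergence
  rw [contr_comm fun i j a b => X a i j b]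
  exact contr_eq_zero fun a b => (hX b).trace₂₃ a

/-- Given the trace part of the second integrability condition, its left-hand side is the sum of
the hook part and of the Weyl part. -/
lemma quadraticForm_eq (hn : 3 ≤ n) (hG : IsMetric G H)
    (hX : ∀ l, IsHarmonic H fun i j k => X i j k l) (hK : IsCurvature K)
    (hβ : ∀ k m, ((n : ℝ) - 1) * β k m = divergence H X k m - ric H K m k - P m k + P k m
      - α m k + G k m * contr H α) (h : TracePartZero G H X K P α) (i j k m : Fin n) :
    quadraticForm G X K P α β i j k m =
      X i j m k - X i k m j + (G j m * divergence H X i k - G k m * divergence H X i j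
        + G i j * divergence H X k m - G i k * divergence H X j m) / (n : ℝ)
      + weylPart G H K i m j k := by
  obtain ⟨hP, c, hc⟩ := h
  have hn' : (3 : ℝ) ≤ n := by exact_mod_cast hn
  have h0 : (n : ℝ) ≠ 0 := by linarith
  have h1 : (n : ℝ) - 1 ≠ 0 := by linarith
  have h2 : (n : ℝ) - 2 ≠ 0 := by linarith
  have hd := divergence_symm hX
  have hr := ric_symm hG hK
  have htr : contr H α = contr H (ric H K) / ((n : ℝ) - 2) + c * n := by
    have e : α = fun i k =>
        divergence H X i k / (n : ℝ) + ric H K i k / ((n : ℝ) - 2) + c * G i k :=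
      funext₂ hc
    rw [e]
    simp only [contr_add, contr_div_const, contr_const_mul, hG.contr_self, contr_divergence hX,
      zero_div, zero_add]
  have hβ' : ∀ k m, β k m = divergence H X k m / (n : ℝ) - ric H K k m / ((n : ℝ) - 2)
      + (c + contr H (ric H K) / (((n : ℝ) - 1) * ((n : ℝ) - 2))) * G k m := fun k m => by
    have h := hβ k m
    rw [htr, hc, hP m k, hd k m, hr k m, hG.symm m k] at h
    apply mul_left_cancel₀ h1
    rw [h]
    field_simp
    ring
  simp only [quadraticForm, weylPart, hβ', hc, hP j k, hG.symm m j, hG.symm m k, hr j m, hr k m]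
  field_simp
  ring

/-- The trace over the first two indices fixes `β`, the traces over `(i,m)` and `(j,m)` give the
trace part; of what remains, the Weyl part is antisymmetric in `(i,m)`, the hook part symmetric. -/
lemma quadraticForm_eq_zero_iff (hn : 3 ≤ n) (hG : IsMetric G H)
    (hX : ∀ l, IsHarmonic H fun i j k => X i j k l) (hK : IsCurvature K)
    (hα : ∀ j k, α j k - α k j = P j k - P k j)
    (hE : ∀ k m, contr H (fun i j => quadraticForm G X K P α β i j k m) = 0) :
    (∀ i j k m, quadraticForm G X K P α β i j k m = 0) ↔
      TracePartZero G H X K P α ∧ HookPartZero G H X ∧ ∀ i j k l, weylPart G H K i j k l = 0 := by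
  have hn' : (3 : ℝ) ≤ n := by exact_mod_cast hn
  have h0 : (n : ℝ) ≠ 0 := by linarith
  have h1 : (n : ℝ) - 1 ≠ 0 := by linarith
  have h2 : (n : ℝ) - 2 ≠ 0 := by linarith
  have hd := divergence_symm hX
  have hr := ric_symm hG hK
  have h12 : ∀ l k, contr H (fun a b => X a b k l) = 0 := fun l k => (hX l).trace k
  have h13 : ∀ l k, contr H (fun a b => X a k b l) = 0 := fun l k => (hX l).trace₁₃ k
  have h23 : ∀ l k, contr H (fun a b => X k a b l) = 0 := fun l k => (hX l).trace₂₃ k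
  -- the trace over the first two indices determines `β`
  have hβ : ∀ k m, ((n : ℝ) - 1) * β k m = divergence H X k m - ric H K m k - P m k + P k m
      - α m k + G k m * contr H α := fun k m => by
    have h := hE k m
    simp only [quadraticForm, contr_sub, contr_add, mul_sub, contr_const_mul, contr_mul_const,
      hG.contr_left, hG.contr_right, hG.contr_self, h12,
      contr_harmonic₁₄] at h
    have e : contr H (fun i j => K i m j k) = ric H K m k := rfl
    have e' : contr H (fun i j => α i j) = contr H α := rfl
    rw [e, e'] at h
    linear_combination h
  constructor
  · intro h
    have hT : TracePartZero G H X K P α := by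
      have him : ∀ j k, (n : ℝ) * (P j k - P k j) + α j k - α k j + β k j - β j k = 0 :=
        fun j k => by
        have h := contr_eq_zero (H := H) fun i m => h i j k m
        simp only [quadraticForm, contr_sub, contr_add, contr_mul_const,
          hG.contr_left, hG.contr_right', hG.contr_self, h13,
          contr_curvature₁₂ hG hK] at h
        linear_combination h
      have hjm : ∀ i k, - divergence H X i k - ric H K i k + P i k - P k i
          + ((n : ℝ) - 1) * α i k + β k i - G i k * contr H β = 0 := fun i k => by
        have h := contr_eq_zero (H := H) fun j m => h i j k m
        simp only [quadraticForm, contr_sub, contr_add, mul_sub, contr_mul_const, contr_const_mul,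
          hG.contr_left', hG.contr_right', hG.contr_self, h23] at h
        have e : contr H (fun j m => K i m j k) = - ric H K i k :=
          (hG.contr_swap fun m j => K i m j k).trans (contr_curvature₂₃ hK i k)
        have e' : contr H (fun j m => X i k m j) = divergence H X i k :=
          (hG.contr_swap fun m j => X i k m j).trans (contr_harmonic₃₄ hX i k)
        have e'' : contr H (fun i j => β i j) = contr H β := rfl
        rw [e, e', e''] at h
        linear_combination h
      have hP : ∀ j k, P j k = P k j := fun j k => by
        have key : ((n : ℝ) - 2) * (n + 2) * (P j k - P k j) = 0 := by
          linear_combination ((n : ℝ) - 1) * him j k - hβ k j + hβ j k - ((n : ℝ) - 2) * hα j k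
            - hd j k - hr j k - hG.symm k j * contr H α
        have h3 : (n : ℝ) + 2 ≠ 0 := by linarith
        simpa [h2, h3, sub_eq_zero] using key
      refine ⟨hP, (((n : ℝ) - 1) * contr H β - contr H α) / (n * (n - 2)), fun i k => ?_⟩
      have e1 := hjm i k
      have e2 := hβ k i
      rw [hP k i, hd i k, hG.symm k i] at *
      field_simp
      linear_combination ((n : ℝ) - 1) * e1 - e2
    have key := quadraticForm_eq hn hG hX hK hβ hT
    refine ⟨hT, fun i j k m => ?_, fun i j k l => ?_⟩
    · have h1 := (key i j k m).symm.trans (h i j k m)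
      have h2 := (key m j k i).symm.trans (h m j k i)
      have hX' : ∀ i j m k, X m j i k = X i j m k := fun i j m k => (hX k).symm₁₃ i j m
      rw [weylPart_antisymm hK, hX' i j m k, hX' i k m j, hG.symm j i, hG.symm k i, hG.symm m j,
        hG.symm m k, hd i k, hd i j, hd k m, hd j m] at h2
      linear_combination (h1 + h2) / 2
    · have h1 := (key i k l j).symm.trans (h i k l j)
      have h2 := (key j k l i).symm.trans (h j k l i)
      have hX' : ∀ i j m k, X m j i k = X i j m k := fun i j m k => (hX k).symm₁₃ i j m
      rw [weylPart_antisymm hK, hX' i k j l, hX' i l j k, hG.symm k i, hG.symm l i, hd i l,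
        hd i k] at h2
      rw [hG.symm k j, hG.symm l j, hd j l, hd j k] at h1
      linear_combination (h1 - h2) / 2
  · rintro ⟨hT, hH, hW⟩ i j k m
    rw [quadraticForm_eq hn hG hX hK hβ hT, hH, hW, add_zero]

/-- The tensor to which the hook symmetriser is applied in the differential condition, for
unspecified tensors. In the application, `(n-2) (α - P) - Ric K` is `Z`. -/
def hookArgument (G H : Tensor2 n) (X K : Tensor4 n) (P α : Tensor2 n) : Tensor4 n :=
  fun i j k l => assemble G (fun i j k => X i j k l) (fun j => P j l) i j k
    + 2 / ((n : ℝ) - 2) * G i k * (((n : ℝ) - 2) * (α j l - P j l) - ric H K j l)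

lemma youngHook_hookArgument (hn : 3 ≤ n) (hG : IsMetric G H)
    (hX : ∀ l, IsHarmonic H fun i j k => X i j k l) {M : Tensor2 n}
    (hM : ∀ i j, M i j = 2 * α i j - 2 / ((n : ℝ) - 2) * ric H K i j) (i j k l : Fin n) :
    youngHook (hookArgument G H X K P α) i j k l =
      6 * X i j k l - 2 * (X i j l k + X j k l i + X i k l j)
      + 2 * (G i j * M k l + G j k * M i l + G i k * M j l)
      - (G i l * (M j k + M k j) + G j l * (M i k + M k i) + G k l * (M i j + M j i))
      - 4 / (n : ℝ) * (G i j * (P k l - P l k) + G j k * (P i l - P l i)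
        + G i k * (P j l - P l j)) := by
  have hn' : (3 : ℝ) ≤ n := by exact_mod_cast hn
  have h2 : (n : ℝ) - 2 ≠ 0 := by linarith
  have s12 : ∀ i j k l, X j i k l = X i j k l := fun i j k l => (hX l).symm₁₂ i j k
  have s13 : ∀ i j k l, X k j i l = X i j k l := fun i j k l => (hX l).symm₁₃ i j k
  have s23 : ∀ i j k l, X i k j l = X i j k l := fun i j k l => (hX l).symm₂₃ i j k
  simp only [youngHook, hookArgument, assemble, hM]
  rw [s12 i j k l, s23 i j k l, s13 i j k l, s12 i k j l |>.trans (s23 i j k l),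
    s12 j k i l |>.symm.trans (s13 i j k l), s12 i j l k, s12 i k l j, s12 j k l i,
    hG.symm j i, hG.symm k i, hG.symm k j]
  field_simp
  ring

/-- The differential condition has no Weyl part: it is the trace part and the hook part of the
second integrability condition. -/
lemma youngHook_eq_zero_iff (hn : 3 ≤ n) (hG : IsMetric G H)
    (hX : ∀ l, IsHarmonic H fun i j k => X i j k l) (hK : IsCurvature K)
    (hα : ∀ j k, α j k - α k j = P j k - P k j) :
    (∀ i j k l, youngHook (hookArgument G H X K P α) i j k l = 0) ↔
      TracePartZero G H X K P α ∧ HookPartZero G H X := by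
  have hn' : (3 : ℝ) ≤ n := by exact_mod_cast hn
  have h0 : (n : ℝ) ≠ 0 := by linarith
  have h2 : (n : ℝ) - 2 ≠ 0 := by linarith
  have h3 : (n : ℝ) + 2 ≠ 0 := by linarith
  have hd := divergence_symm hX
  have hr := ric_symm hG hK
  have h12 : ∀ l k, contr H (fun a b => X a b k l) = 0 := fun l k => (hX l).trace k
  obtain ⟨M, hM⟩ : ∃ M : Tensor2 n, ∀ i j, M i j = 2 * α i j - 2 / ((n : ℝ) - 2) * ric H K i j :=
    ⟨_, fun _ _ => rfl⟩
  have hY := youngHook_hookArgument (P := P) hn hG hX hM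
  have s12 : ∀ i j k l, X j i k l = X i j k l := fun i j k l => (hX l).symm₁₂ i j k
  have s13 : ∀ i j k l, X k j i l = X i j k l := fun i j k l => (hX l).symm₁₃ i j k
  have s23 : ∀ i j k l, X i k j l = X i j k l := fun i j k l => (hX l).symm₂₃ i j k
  -- once the trace part vanishes, the remainder only involves `X` and its divergence
  have red : TracePartZero G H X K P α → ∀ i j k l,
      youngHook (hookArgument G H X K P α) i j k l =
        6 * X i j k l - 2 * (X i j l k + X j k l i + X i k l j)
        + 4 / (n : ℝ) * (G i j * divergence H X k l + G j k * divergence H X i l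
          + G i k * divergence H X j l - G i l * divergence H X j k - G j l * divergence H X i k
          - G k l * divergence H X i j) := by
    rintro ⟨hP, c, hc⟩ i j k l
    have hM' : ∀ i j, M i j = 2 / (n : ℝ) * divergence H X i j + 2 * c * G i j := fun i j => by
      rw [hM, hc]; field_simp; ring
    rw [hY, hP l k, hP l i, hP l j]
    simp only [hM', hd j k, hd i k, hd i j, hG.symm k j, hG.symm k i, hG.symm j i]
    ring
  constructor
  · intro h
    have hT : TracePartZero G H X K P α := by
      have tr : ∀ k l, 2 * (n + 2) * M k l - 4 * divergence H X k l - 2 * (M k l + M l k)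
          - 2 * (G k l * contr H M) - 4 / (n : ℝ) * (n + 2) * (P k l - P l k) = 0 := fun k l => by
        have e := contr_eq_zero (H := H) fun i j => (hY i j k l).symm.trans (h i j k l)
        simp only [contr_sub, contr_add, contr_mul_const, contr_const_mul, mul_sub, mul_add,
          hG.contr_left, hG.contr_right, hG.contr_self, h12, contr_harmonic₁₄] at e
        have e1 : contr H (fun a b => X b k l a) = divergence H X k l :=
          hG.contr_swap fun a b => X a k l b
        have e2 : contr H (fun a b => M b a) = contr H M := hG.contr_swap M
        rw [e1, e2] at e
        linear_combination e
      have hP : ∀ j k, P j k = P k j := fun j k => by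
        have hMa : M j k - M k j = 2 * (P j k - P k j) := by
          rw [hM, hM, hr j k]; linear_combination 2 * hα j k
        have key : 4 * ((n : ℝ) + 2) * (n - 2) * (P j k - P k j) = 0 := by
          have t1 := tr j k
          have t2 := tr k j
          field_simp at t1 t2
          rw [← hG.symm j k, hd j k] at t2
          linear_combination t1 - t2 - 2 * (n : ℝ) * ((n : ℝ) + 2) * hMa
        simpa [h2, h3, sub_eq_zero] using key
      refine ⟨hP, contr H M / (2 * n), fun i k => ?_⟩
      have e1 := tr i k
      have e2 : M k i = M i k := by
        rw [hM, hM, hr i k]; linear_combination 2 * hα k i - 2 * hP i k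
      rw [hP k i, e2] at e1
      have eM : M i k = 2 / (n : ℝ) * divergence H X i k + contr H M / n * G i k := by
        field_simp
        linear_combination e1 / 2
      linear_combination (eM - hM i k) / 2
    refine ⟨hT, fun i j k m => ?_⟩
    have e1 := (red hT i j m k).symm.trans (h i j m k)
    have e2 := (red hT i k m j).symm.trans (h i k m j)
    rw [s23 i k m j, hG.symm m k, hd k m] at e1
    rw [s23 i j k m, s13 j m k i, s23 i j m k, hG.symm k j, hG.symm m j, hd j m, hd j k] at e2
    linear_combination (e1 - e2) / 8
  · rintro ⟨hT, hH⟩ i j k l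
    rw [red hT]
    have e1 := hH i l k j
    have e2 := hH i l j k
    have e3 := hH j l i k
    rw [s23 i j l k, s23 i j k l, hG.symm l j, hG.symm k j, hd j k, hd j l] at e1
    rw [s23 i k l j, hG.symm l k, hd k l] at e2
    rw [s23 j k l i, s12 i j k l, hG.symm j i, hG.symm l k, hd k l, hd i j] at e3
    linear_combination -2 * (e1 + e2 + e3)

end Curvature

/-! ### The conditions at a point for an assembled structure tensor -/

section Assembled

variable {n : ℕ} {G H : Tensor2 n}

/-- The Kulkarni–Nomizu product of the metric with `σ`. -/
def kulkarni (G σ : Tensor2 n) : Tensor4 n := fun i j k l =>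
  G i k * σ j l + G j l * σ i k - G j k * σ i l - G i l * σ j k

lemma weylPart_linear (a b : ℝ) (K L : Tensor4 n) (i j k l : Fin n) :
    weylPart G H (fun i j k l => a * K i j k l + b * L i j k l) i j k l
      = a * weylPart G H K i j k l + b * weylPart G H L i j k l := by
  have e : ric H (fun i j k l => a * K i j k l + b * L i j k l)
      = fun i k => a * ric H K i k + b * ric H L i k := by
    ext i k
    simp only [ric, contr_add, contr_const_mul]
  simp only [weylPart, e, contr_add, contr_const_mul]
  ring

lemma weylPart_kulkarni (hn : 3 ≤ n) (hG : IsMetric G H) (σ : Tensor2 n)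
    (i j k l : Fin n) :
    weylPart G H (kulkarni G σ) i j k l = 0 := by
  have hn' : (3 : ℝ) ≤ n := by exact_mod_cast hn
  have h1 : (n : ℝ) - 1 ≠ 0 := by linarith
  have h2 : (n : ℝ) - 2 ≠ 0 := by linarith
  have e : ric H (kulkarni G σ) = fun i k => ((n : ℝ) - 2) * σ i k + G i k * contr H σ := by
    ext i k
    simp only [ric, kulkarni, contr_add, contr_sub, contr_const_mul, contr_mul_const,
      hG.contr_self, hG.contr_left, hG.contr_right']
    ring
  simp only [weylPart, e, kulkarni, contr_add, contr_const_mul, contr_mul_const,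
    hG.contr_self]
  field_simp
  ring

/-- The tensor `S_{ik}^a S_{alj} - S_{il}^a S_{akj} + R_{ijkl}`, which has the symmetries of a
curvature tensor if `S` is harmonic. The Weyl condition is the vanishing of its Weyl part. -/
def squareCurvature (H : Tensor2 n) (S : Tensor3 n) (R : Tensor4 n) : Tensor4 n := fun i j k l =>
  dot H (S i k) (S l j) - dot H (S i l) (S k j) + R i j k l

lemma isCurvature_squareCurvature (hG : IsMetric G H) {S : Tensor3 n} (hS : IsHarmonic H S)
    {R : Tensor4 n} (hR : IsCurvature R) : IsCurvature (squareCurvature H S R) := by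
  have c : ∀ i j k l, dot H (S i j) (S k l) = dot H (S k l) (S i j) := fun i j k l =>
    hG.dot_comm _ _
  have e : ∀ i j, S j i = S i j := fun i j => funext (hS.symm₁₂ i j)
  refine ⟨fun i j k l => ?_, fun i j k l => ?_, fun i j k l => ?_⟩
  · simp only [squareCurvature, hR.antisymm₁₂ i j k l]
    rw [c j k l i, c j l k i, e i l, e k j, e i k, e l j]
    ring
  · simp only [squareCurvature, hR.antisymm₃₄ i j k l]
    ring
  · have := hR.bianchi i j k l
    simp only [squareCurvature]
    rw [e l k, e l j, e k j]
    linear_combination this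

/-- The contraction `S_i^{ab} S_{jab}`. -/
def square (H : Tensor2 n) (S : Tensor3 n) : Tensor2 n := fun i j =>
  contr H fun a b => dot H (S i a) (S j b)

lemma square_eq_sum (hG : IsMetric G H) (S : Tensor3 n) (i j : Fin n) :
    square H S i j = ∑ a, ∑ b, ∑ c, ∑ d, H a c * H b d * S i c d * S j a b := by
  unfold square
  rw [← hG.contr_swap]
  refine Finset.sum_congr rfl fun a _ => ?_
  conv_rhs => rw [Finset.sum_comm]
  refine Finset.sum_congr rfl fun b _ => ?_
  beta_reduce
  rw [hG.dot_comm, dot, Finset.mul_sum]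
  simp only [Finset.mul_sum]
  exact Finset.sum_congr rfl fun c _ => Finset.sum_congr rfl fun d _ => by ring

lemma ric_squareCurvature (hG : IsMetric G H) {S : Tensor3 n} (hS : IsHarmonic H S)
    (R : Tensor4 n) (i k : Fin n) :
    ric H (squareCurvature H S R) i k = ric H R i k - square H S i k := by
  have e : ∀ i j, S j i = S i j := fun i j => funext (hS.symm₁₂ i j)
  have h0 : ∀ x : Fin n → ℝ, contr H (fun a b => dot H (S a b) x) = 0 := fun x => by
    simp only [dot_eq_contr]
    rw [contr_comm fun a b c d => S a b c * x d]
    simp [contr_mul_const, hS.trace, contr_zero]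
  have h1 : contr H (fun a b => dot H (S a k) (S b i)) = square H S i k := by
    unfold square
    rw [← hG.contr_swap]
    refine congrArg (contr H) (funext₂ fun a b => ?_)
    rw [hG.dot_comm, e i a, e k b]
  simp only [ric, squareCurvature, contr_add, contr_sub, h0, h1]
  ring

/-- `T_{ijm,k} + T_{ij}^a T_{akm} - R_{ijkm}` for a derivative `D` of `T`. -/
def formQ (H : Tensor2 n) (T : Tensor3 n) (D R : Tensor4 n) : Tensor4 n := fun i j k m =>
  D i j m k + dot H (T i j) (fun b => T b k m) - R i j k m

/-- The contraction of `formQ` in its first and third index. -/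
def formq (H : Tensor2 n) (T : Tensor3 n) (D R : Tensor4 n) : Tensor2 n := fun j m =>
  contr H fun i a => formQ H T D R i j a m

/-- The left-hand side of the second integrability condition. -/
def quadraticExpr (G H : Tensor2 n) (T : Tensor3 n) (D R : Tensor4 n) : Tensor4 n :=
  fun i j k l =>
    (formQ H T D R i j k l + 1 / ((n : ℝ) - 1) * G i j * formq H T D R k l)
      - (formQ H T D R i k j l + 1 / ((n : ℝ) - 1) * G i k * formq H T D R j l)

variable {S : Tensor3 n} {s : Fin n → ℝ} {X : Tensor4 n} {P : Tensor2 n} {R : Tensor4 n}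

/-- The trace tensor that accompanies the metric in the second integrability condition. -/
def alphaForm (H : Tensor2 n) (S : Tensor3 n) (s : Fin n → ℝ) (P : Tensor2 n) : Tensor2 n :=
  fun i k => P i k - dot H (S i k) s - s i * s k

lemma quadraticExpr_eq_quadraticForm (hn : 3 ≤ n) (hG : IsMetric G H) (hS : IsHarmonic H S)
    (hR : IsCurvature R) {D : Tensor4 n}
    (hD : ∀ i j k l, D i j k l = assemble G (fun i j k => X i j k l) (fun j => P j l) i j k) :
    ∃ β, ∀ i j k l, quadraticExpr G H (assemble G S s) D R i j k l =
      quadraticForm G X (squareCurvature H S R) P (alphaForm H S s P) β i j k l := by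
  have hn' : (3 : ℝ) ≤ n := by exact_mod_cast hn
  have h0 : (n : ℝ) ≠ 0 := by linarith
  have c : ∀ i j, dot H s (S i j) = dot H (S i j) s := fun i j => hG.dot_comm _ _
  have e1 : ∀ i j, (fun b => S b i j) = S i j := fun i j => funext fun b => by
    rw [hS.symm₁₂ i b j, hS.symm₂₃ i j b]
  have eT : ∀ i j, assemble G S s i j =
      fun k => S i j k + G i k * s j + G j k * s i - 2 / (n : ℝ) * (G i j * s k) :=
    fun _ _ => rfl
  refine ⟨fun k m => formq H (assemble G S s) D R k m / ((n : ℝ) - 1)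
    - 2 / (n : ℝ) * (P m k + dot H (S k m) s - 2 / (n : ℝ) * (s k * s m) + dot H s s * G k m),
    fun i j k m => ?_⟩
  have hB := hR.bianchi i j k m
  have hA := hR.antisymm₃₄ i k j m
  obtain ⟨q, hq⟩ : ∃ q, formq H (assemble G S s) D R = q := ⟨_, rfl⟩
  simp only [quadraticExpr, hq]
  simp only [formQ, hD, quadraticForm, squareCurvature, alphaForm, eT, assemble,
    dot_add_left, dot_sub_left, dot_add_right, dot_sub_right, dot_mul_const_left,
    dot_const_mul_left, dot_mul_const_right, dot_const_mul_right, hG.dot_left', hG.dot_right, e1, c]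
  rw [hS.symm₂₃ i j k, hG.symm k j, hS.symm₂₃ j k m]
  linear_combination -hB + hA + s j * hS.rotate i k m + s i * hS.rotate j k m
    - s k * hS.rotate i j m

lemma contr_quadraticExpr (hn : 3 ≤ n) (hG : IsMetric G H) (hS : IsHarmonic H S)
    (hX : ∀ l, IsHarmonic H fun i j k => X i j k l) (hR : IsCurvature R) {D : Tensor4 n}
    (hD : ∀ i j k l, D i j k l = assemble G (fun i j k => X i j k l) (fun j => P j l) i j k)
    (k m : Fin n) :
    contr H (fun i j => quadraticExpr G H (assemble G S s) D R i j k m) = 0 := by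
  have hn' : (3 : ℝ) ≤ n := by exact_mod_cast hn
  have h0 : (n : ℝ) ≠ 0 := by linarith
  have h1 : (n : ℝ) - 1 ≠ 0 := by linarith
  have hA : ∀ {Y : Tensor3 n} (_ : IsHarmonic H Y) (y : Fin n → ℝ) (c : Fin n),
      contr H (fun i j => assemble G Y y i j c) = 0 := fun {Y} hY y c => by
    simp only [assemble, contr_sub, contr_add, contr_const_mul, contr_mul_const, hG.contr_self,
      hG.contr_left, hG.contr_right, hY.trace]
    field_simp
    ring
  have hd : contr H (fun i j => dot H (assemble G S s i j) fun b => assemble G S s b k m) = 0 := by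
    simp only [dot_eq_contr]
    rw [contr_comm fun i j a b => assemble G S s i j a * assemble G S s b k m]
    simp [contr_mul_const, hA hS, contr_zero]
  have e1 : contr H (fun i j => formQ H (assemble G S s) D R i j k m) = 0 := by
    simp only [formQ, contr_sub, contr_add, hD, hd, hA (hX _), contr_curvature₁₂ hG hR]
    ring
  have e2 : contr H (fun i j => formQ H (assemble G S s) D R i k j m)
      = formq H (assemble G S s) D R k m := rfl
  have e3 : contr H (fun i j => 1 / ((n : ℝ) - 1) * G i k * formq H (assemble G S s) D R j m)
      = 1 / ((n : ℝ) - 1) * formq H (assemble G S s) D R k m := by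
    simp only [mul_assoc, contr_const_mul, hG.contr_left]
  simp only [quadraticExpr, contr_sub, contr_add, e1, e2, e3, contr_mul_const, contr_const_mul,
    hG.contr_self]
  field_simp
  ring

/-- The tensor `Z` of the differential condition. -/
def formZ (H : Tensor2 n) (S : Tensor3 n) (s : Fin n → ℝ) (R : Tensor4 n) : Tensor2 n :=
  fun i j => square H S i j - ((n : ℝ) - 2) * (dot H (S i j) s + s i * s j) - ric H R i j

/-- The trace terms of `T` only contribute a Kulkarni–Nomizu product to its Riemann-symmetrised
square. -/
lemma youngRiemannAdjoint_assemble (hn : 3 ≤ n) (hG : IsMetric G H) (hS : IsHarmonic H S)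
    (R : Tensor4 n) :
    ∃ σ, youngRiemannAdjoint (fun i j k l =>
        dot H (fun a => assemble G S s a j l) (fun b => assemble G S s b i k)) =
      fun i j k l => 1 * (8 * squareCurvature H S R i j k l + (-8) * R i j k l)
        + 2 * kulkarni G σ i j k l := by
  have hn' : (3 : ℝ) ≤ n := by exact_mod_cast hn
  have h0 : (n : ℝ) ≠ 0 := by linarith
  have c : ∀ i j, dot H s (S i j) = dot H (S i j) s := fun i j => hG.dot_comm _ _
  have e1 : ∀ i j, (fun b => S b i j) = S i j := fun i j => funext fun b => by
    rw [hS.symm₁₂ i b j, hS.symm₂₃ i j b]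
  have e : ∀ i j, S j i = S i j := fun i j => funext (hS.symm₁₂ i j)
  -- the symmetrisation in `(i,k)` and `(j,l)` may be carried out in the two factors
  have hB : ∀ i k, (fun b => assemble G S s b i k + assemble G S s b k i) = fun b =>
      2 * S b i k + (1 - 2 / (n : ℝ)) * (G b k * s i + G b i * s k) + 2 * (G i k * s b) :=
    fun i k => funext fun b => by
      simp only [assemble, hS.symm₂₃ b i k, hG.symm k i]
      ring
  refine ⟨fun i j => 4 * dot H (S i j) s + (4 * (1 - 2 / (n : ℝ)) - (1 - 2 / (n : ℝ)) ^ 2)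
    * (s i * s j) + 2 * dot H s s * G i j, funext₂ fun i j => funext₂ fun k l => ?_⟩
  have hV : ∀ i j k l, dot H (fun a => assemble G S s a j l) (fun b => assemble G S s b i k)
      + dot H (fun a => assemble G S s a j l) (fun b => assemble G S s b k i)
      + dot H (fun a => assemble G S s a l j) (fun b => assemble G S s b i k)
      + dot H (fun a => assemble G S s a l j) (fun b => assemble G S s b k i)
      = 4 * dot H (S i k) (S j l) + 2 * (1 - 2 / (n : ℝ)) * (S k j l * s i + S i j l * s k
        + S i k l * s j + S i k j * s l) + 4 * (G i k * dot H (S j l) s + G j l * dot H (S i k) s)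
        + (1 - 2 / (n : ℝ)) ^ 2 * (G l k * s j * s i + G k j * s i * s l + G i l * s k * s j
          + G j i * s k * s l) + 4 * (1 - 2 / (n : ℝ)) * (G i k * s j * s l + G j l * s i * s k)
        + 4 * (G i k * G j l * dot H s s) := fun i j k l => by
    have e0 : ∀ x y z w : Fin n → ℝ, dot H (fun b => x b + y b) (fun b => z b + w b)
      = dot H x z + dot H x w + dot H y z + dot H y w := fun x y z w => by
      simp only [dot_add_left, dot_add_right]; ring
    rw [← e0, hB, hB]
    simp only [dot_add_left, dot_add_right, dot_mul_const_left,
      dot_const_mul_left, dot_mul_const_right, dot_const_mul_right, hG.dot_left,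
      hG.dot_right, e1, c]
    rw [hG.dot_comm (S i k) (S j l), hG.symm k l, hG.symm k j, hG.symm i l, hG.symm i j]
    ring
  have hY : ∀ N : Tensor4 n, youngRiemannAdjoint N i j k l =
      (N i j k l + N k j i l + N i l k j + N k l i j)
      - (N j i k l + N k i j l + N j l k i + N k l j i)
      - (N i j l k + N l j i k + N i k l j + N l k i j)
      + (N j i l k + N l i j k + N j k l i + N l k j i) := fun N => rfl
  refine (hY _).trans ?_
  rw [hV i j k l, hV j i k l, hV i j l k, hV j i l k, hG.dot_comm (S j k) (S i l),
    hG.dot_comm (S j l) (S i k)]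
  simp only [squareCurvature, kulkarni, e j l, e j k, hG.symm j i, hG.symm k i, hG.symm l i,
    hG.symm k j, hG.symm l j, hG.symm l k,
    hS.symm₁₂ i j k, hS.symm₂₃ i j k, hS.rotate i j k,
    hS.symm₁₂ i j l, hS.symm₂₃ i j l, hS.rotate i j l,
    hS.symm₁₂ i k l, hS.symm₂₃ i k l, (hS.rotate l i k).symm,
    hS.symm₁₂ j k l, hS.symm₂₃ j k l, (hS.rotate l j k).symm]
  ring

/-- At a point, the second integrability condition amounts to the Weyl condition and the
differential condition. -/
theorem quadraticExpr_eq_zero_iff (hn : 3 ≤ n) (hG : IsMetric G H) (hS : IsHarmonic H S)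
    (hX : ∀ l, IsHarmonic H fun i j k => X i j k l) (hR : IsCurvature R) {D : Tensor4 n}
    (hD : ∀ i j k l, D i j k l = assemble G (fun i j k => X i j k l) (fun j => P j l) i j k) :
    (∀ i j k l, quadraticExpr G H (assemble G S s) D R i j k l = 0) ↔
      (∀ i j k l, (1 / 8) * weylPart G H (youngRiemannAdjoint (fun i j k l =>
        dot H (fun a => assemble G S s a j l) (fun b => assemble G S s b i k))) i j k l
          = - weylPart G H R i j k l) ∧
      ∀ i j k l, youngHook (fun i j k l => D i j k l
        + 2 / ((n : ℝ) - 2) * G i k * formZ H S s R j l) i j k l = 0 := by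
  have hK := isCurvature_squareCurvature hG hS hR
  obtain ⟨β, hβ⟩ := quadraticExpr_eq_quadraticForm (s := s) hn hG hS hR hD
  obtain ⟨σ, hσ⟩ := youngRiemannAdjoint_assemble (s := s) hn hG hS R
  have hE := contr_quadraticExpr (s := s) hn hG hS hX hR hD
  have hα : ∀ j k, alphaForm H S s P j k - alphaForm H S s P k j = P j k - P k j := fun j k => by
    have : S k j = S j k := funext (hS.symm₁₂ j k)
    simp only [alphaForm, this]
    ring
  have hZ : (fun i j k l => D i j k l + 2 / ((n : ℝ) - 2) * G i k * formZ H S s R j l)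
      = hookArgument G H X (squareCurvature H S R) P (alphaForm H S s P) :=
    funext₂ fun i j => funext₂ fun k l => by
      simp only [hD, hookArgument, formZ, alphaForm, ric_squareCurvature hG hS]
      ring
  simp only [hβ] at hE ⊢
  rw [quadraticForm_eq_zero_iff hn hG hX hK hα hE, hZ, youngHook_eq_zero_iff hn hG hX hK hα, hσ,
    ← and_assoc, and_comm]
  refine and_congr_left fun _ => forall₄_congr fun i j k l => ?_
  rw [weylPart_linear, weylPart_linear, weylPart_kulkarni hn hG]
  constructor <;> intro h <;> linarith

end Assembled

/-! ### The conditions at a point for the structure tensor -/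

section Pointwise

variable {n : ℕ}

lemma isMetric_inv {A : Matrix (Fin n) (Fin n) ℝ} (hs : ∀ i j, A i j = A j i)
    (hd : IsUnit A.det) : IsMetric (fun i j => A i j) (fun i j => A⁻¹ i j) := by
  refine ⟨hs, fun i j => ?_, fun i j => ?_⟩
  · have h : A.transpose = A := Matrix.ext fun i j => hs j i
    have h' := Matrix.transpose_nonsing_inv A
    rw [h] at h'
    exact (congrFun₂ h' i j).symm
  · rw [← Matrix.mul_apply, Matrix.nonsing_inv_mul _ hd, Matrix.one_apply]

variable {G : Coord n → Matrix (Fin n) (Fin n) ℝ} {T : Coord n → Tensor3 n} {y : Coord n}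

lemma traceFree3_eq (A : Tensor3 n) (B : Matrix (Fin n) (Fin n) ℝ) {u v w : Fin n → ℝ}
    (hu : ∀ c, contr (fun i j => B⁻¹ i j) (fun a b => A a b c) = u c)
    (hv : ∀ c, contr (fun i j => B⁻¹ i j) (fun a b => A a c b) = v c)
    (hw : ∀ c, contr (fun i j => B⁻¹ i j) (fun a b => A c a b) = w c) (i j k : Fin n) :
    traceFree3 B A i j k = A i j k
      - (B i j * (u k - (u k + v k + w k) / ((n : ℝ) + 2))
        + B i k * (v j - (u j + v j + w j) / ((n : ℝ) + 2))
        + B j k * (w i - (u i + v i + w i) / ((n : ℝ) + 2))) / ((n : ℝ) - 1) := by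
  simp only [← hu, ← hv, ← hw]
  rfl

/-- The linear condition and the hook condition are the same equation: `T` is trace-free in its
first two indices, so that subtracting the traces of `2 (T_{ijk} - T_{ikj})` produces the two terms
with `t`. -/
lemma linearConditionAt_iff (hn : 3 ≤ n)
    (hG : IsMetric (fun i j => G y i j) (fun i j => (G y)⁻¹ i j))
    (hT : StructureSymmetriesAt G T y) : LinearConditionAt G T y ↔ HookConditionAt G T y := by
  have hn' : (3 : ℝ) ≤ n := by exact_mod_cast hn
  have h1 : (n : ℝ) - 1 ≠ 0 := by linarith
  obtain ⟨hs, htr⟩ := hT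
  have htr' : ∀ k, contr (fun i j => (G y)⁻¹ i j) (fun i j => T y i j k) = 0 := htr
  have ht : ∀ c, contr (fun i j => (G y)⁻¹ i j) (fun a b => T y a c b) = tTrace G T y c :=
    fun _ => rfl
  have ht' : ∀ c, contr (fun i j => (G y)⁻¹ i j) (fun a b => T y b c a) = tTrace G T y c :=
    fun c => (hG.contr_swap fun a b => T y a c b).trans (ht c)
  have hA : youngHookAdjoint (T y) = fun i j k => 2 * T y i j k - (T y i k j + T y k i j) := by
    funext i j k
    simp only [youngHookAdjoint, hs i j k]
    ring
  refine forall₃_congr fun i j k => ?_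
  rw [hA, traceFree3_eq (u := fun c => -2 * tTrace G T y c) (v := fun c => 2 * tTrace G T y c)
    (w := fun c => 0)]
  · have e : T y k i j = T y i k j := hs i k j
    rw [e]
    constructor
    · intro h
      linear_combination 2 * h
    · intro h
      linear_combination h / 2
  · intro c
    have e : contr (fun i j => (G y)⁻¹ i j) (fun a b => T y c a b) = tTrace G T y c :=
      (congrArg (contr _) (funext₂ fun a b => hs a c b)).trans (ht c)
    simp only [contr_sub, contr_add, contr_const_mul, htr', ht]
    rw [show contr (fun i j => (G y)⁻¹ i j) (fun a b => T y c a b) = tTrace G T y c from e]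
    ring
  · intro c
    have e : contr (fun i j => (G y)⁻¹ i j) (fun a b => T y b a c) = 0 :=
      (hG.contr_swap fun a b => T y a b c).trans (htr' c)
    simp only [contr_sub, contr_add, contr_const_mul, htr', ht, e]
    ring
  · intro c
    have e : ∀ b a, T y c a b = T y a c b := fun b a => hs a c b
    simp only [contr_sub, contr_add, contr_const_mul, e, ht, ht']
    ring

lemma tBar_eq (hT : StructureSymmetriesAt G T y) (i : Fin n) :
    tBar G T y i = (n : ℝ) / (((n : ℝ) + 2) * ((n : ℝ) - 1)) * tTrace G T y i := by
  simp only [tBar, tTrace, hT.1 i]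

lemma exists_harmonic (hn : 3 ≤ n)
    (hG : IsMetric (fun i j => G y i j) (fun i j => (G y)⁻¹ i j))
    (hT : StructureSymmetriesAt G T y) (hI : LinearConditionAt G T y) :
    ∃ S, IsHarmonic (fun i j => (G y)⁻¹ i j) S ∧
      T y = assemble (fun i j => G y i j) S (tBar G T y) := by
  obtain ⟨S, hS, h⟩ := exists_assemble hn hG hT.1 hT.2 hI
  refine ⟨S, hS, ?_⟩
  rw [show tBar G T y = _ from funext (tBar_eq hT)]
  exact h

lemma tRing_eq (hn : 3 ≤ n)
    (hG : IsMetric (fun i j => G y i j) (fun i j => (G y)⁻¹ i j)) {S : Tensor3 n}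
    (hS : IsHarmonic (fun i j => (G y)⁻¹ i j) S) {s : Fin n → ℝ}
    (h : T y = assemble (fun i j => G y i j) S s) : tRing G T y = S := by
  have hn' : (3 : ℝ) ≤ n := by exact_mod_cast hn
  have h0 : (n : ℝ) ≠ 0 := by linarith
  have h1 : (n : ℝ) - 1 ≠ 0 := by linarith
  have h2 : (n : ℝ) + 2 ≠ 0 := by linarith
  obtain ⟨g, hg⟩ : ∃ g : Tensor2 n, (fun i j => G y i j) = g := ⟨_, rfl⟩
  have hg' : ∀ i j, G y i j = g i j := fun i j => congrFun₂ hg i j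
  rw [hg] at hG h
  obtain ⟨c, hc⟩ : ∃ c : ℝ, c = (2 - 2 / (n : ℝ)) / 3 := ⟨_, rfl⟩
  have hU : (fun i j k => (1 / 6) * youngSym (T y) i j k) = fun i j k =>
      S i j k + c * (G y i j * s k + G y i k * s j + G y j k * s i) := by
    funext i j k
    simp only [youngSym, h, assemble, hg', hG.symm j i, hG.symm k i, hG.symm k j, hc,
      hS.symm₁₂ i j k, hS.symm₂₃ i j k, hS.symm₁₃ i j k, hS.rotate i j k, (hS.rotate k i j).symm]
    ring
  funext i j k
  rw [tRing, hU, traceFree3_eq (u := fun i => c * (n + 2) * s i) (v := fun i => c * (n + 2) * s i)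
    (w := fun i => c * (n + 2) * s i)]
  · simp only [hg']
    field_simp
    ring
  all_goals
    intro c
    simp only [hg', contr_add, contr_const_mul, contr_mul_const, hG.contr_self, hG.contr_left,
      hG.contr_right, hG.contr_left', hG.contr_right', hS.trace, hS.trace₁₃, hS.trace₂₃]
    ring

/-- Under the first condition, the second integrability condition at a point is equivalent to the
Weyl condition together with the differential condition. -/
theorem quadraticConditionAt_iff (hn : 3 ≤ n)
    (hG : IsMetric (fun i j => G y i j) (fun i j => (G y)⁻¹ i j)) {S : Tensor3 n}
    (hS : IsHarmonic (fun i j => (G y)⁻¹ i j) S)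
    (hT : T y = assemble (fun i j => G y i j) S (tBar G T y))
    {X : Tensor4 n} (hX : ∀ l, IsHarmonic (fun i j => (G y)⁻¹ i j) fun i j k => X i j k l)
    {P : Tensor2 n} (hD : ∀ i j k l, covDeriv3 G T y i j k l =
      assemble (fun i j => G y i j) (fun i j k => X i j k l) (fun j => P j l) i j k)
    (hR : IsCurvature (riemann G y)) :
    QuadraticConditionAt G T y ↔ WeylConditionAt G T y ∧ DifferentialConditionAt G T y := by
  have key := quadraticExpr_eq_zero_iff (s := tBar G T y) hn hG hS hX hR hD
  rw [← hT] at key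
  have hZ : formZ (fun i j => (G y)⁻¹ i j) S (tBar G T y) (riemann G y) = tensorZ G T y := by
    funext i j
    have e1 : square (fun i j => (G y)⁻¹ i j) S i j =
        ∑ a, ∑ b, ∑ c, ∑ d, (G y)⁻¹ a c * (G y)⁻¹ b d * S i c d * S j a b :=
      square_eq_sum hG S i j
    have e2 : dot (fun i j => (G y)⁻¹ i j) (S i j) (tBar G T y) =
        ∑ a, ∑ b, (G y)⁻¹ a b * S i j b * tBar G T y a := by
      rw [hG.dot_comm]
      exact Finset.sum_congr rfl fun a _ => Finset.sum_congr rfl fun b _ => by ring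
    simp only [formZ, tensorZ, e1, e2, tRing_eq hn hG hS hT]
    rfl
  have hW : (fun i j k l => dot (fun i j => (G y)⁻¹ i j) (fun a => T y a j l) fun b => T y b i k)
      = fun i j k l => ∑ a, ∑ b, (G y)⁻¹ a b * T y b i k * T y a j l := by
    funext i j k l
    exact Finset.sum_congr rfl fun a _ => Finset.sum_congr rfl fun b _ => by ring
  rw [hZ, hW] at key
  exact key

end Pointwise

/-! ### Partial derivatives -/

section Calculus

variable {n : ℕ} {U : Set (Coord n)} {f g : Coord n → ℝ} {y : Coord n}

lemma pderiv_congr (hU : IsOpen U) (hy : y ∈ U) (h : ∀ z ∈ U, f z = g z) (l : Fin n) :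
    pderiv l f y = pderiv l g y := by
  unfold pderiv
  rw [Filter.EventuallyEq.fderiv_eq (Filter.eventuallyEq_of_mem (hU.mem_nhds hy) h)]

lemma pderiv_const (c : ℝ) (l : Fin n) : pderiv l (fun _ => c) y = 0 := by
  simp [pderiv]

lemma pderiv_add (hf : DifferentiableAt ℝ f y) (hg : DifferentiableAt ℝ g y) (l : Fin n) :
    pderiv l (fun z => f z + g z) y = pderiv l f y + pderiv l g y := by
  simp [pderiv, fderiv_fun_add hf hg]

lemma pderiv_sub (hf : DifferentiableAt ℝ f y) (hg : DifferentiableAt ℝ g y) (l : Fin n) :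
    pderiv l (fun z => f z - g z) y = pderiv l f y - pderiv l g y := by
  simp [pderiv, fderiv_fun_sub hf hg]

lemma pderiv_mul (hf : DifferentiableAt ℝ f y) (hg : DifferentiableAt ℝ g y) (l : Fin n) :
    pderiv l (fun z => f z * g z) y = pderiv l f y * g y + f y * pderiv l g y := by
  simp [pderiv, fderiv_fun_mul hf hg]
  ring

lemma pderiv_const_mul (hf : DifferentiableAt ℝ f y) (c : ℝ) (l : Fin n) :
    pderiv l (fun z => c * f z) y = c * pderiv l f y := by
  rw [pderiv_mul (differentiableAt_const c) hf, pderiv_const, zero_mul, zero_add]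

lemma pderiv_sum {ι : Type*} (s : Finset ι) {f : ι → Coord n → ℝ}
    (hf : ∀ a ∈ s, DifferentiableAt ℝ (f a) y) (l : Fin n) :
    pderiv l (fun z => ∑ a ∈ s, f a z) y = ∑ a ∈ s, pderiv l (f a) y := by
  simp [pderiv, fderiv_fun_sum hf]

lemma contDiffOn_pderiv (hU : IsOpen U) (hf : ContDiffOn ℝ ∞ f U) (l : Fin n) :
    ContDiffOn ℝ ∞ (pderiv l f) U :=
  (hf.fderiv_of_isOpen hU (by simp)).clm_apply contDiffOn_const

lemma pderiv_comm (hU : IsOpen U) (hf : ContDiffOn ℝ ∞ f U) (hy : y ∈ U) (j k : Fin n) :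
    pderiv j (pderiv k f) y = pderiv k (pderiv j f) y := by
  have hc : ContDiffAt ℝ ∞ f y := hf.contDiffAt (hU.mem_nhds hy)
  have hd : DifferentiableAt ℝ (fderiv ℝ f) y :=
    ((hf.fderiv_of_isOpen hU (m := ∞) (by simp)).contDiffAt (hU.mem_nhds hy)).differentiableAt
      (by simp)
  have hs : IsSymmSndFDerivAt ℝ f y := hc.isSymmSndFDerivAt (by
    simpa using (mod_cast le_top : ((2 : ℕ∞) : WithTop ℕ∞) ≤ ∞))
  have e : ∀ j k : Fin n, pderiv j (pderiv k f) y =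
      fderiv ℝ (fderiv ℝ f) y (EuclideanSpace.single j 1) (EuclideanSpace.single k 1) := by
    intro j k
    have : pderiv k f = fun z => fderiv ℝ f z (EuclideanSpace.single k 1) := rfl
    rw [pderiv, this, fderiv_clm_apply hd (differentiableAt_const _)]
    simp
  rw [e, e, hs]

lemma differentiableAt_of_contDiffOn (hU : IsOpen U) (hf : ContDiffOn ℝ ∞ f U) (hy : y ∈ U) :
    DifferentiableAt ℝ f y :=
  (hf.contDiffAt (hU.mem_nhds hy)).differentiableAt (by simp)

/-- A matrix of functions with smooth entries. -/
def SmoothMatrix (U : Set (Coord n)) (A : Coord n → Matrix (Fin n) (Fin n) ℝ) : Prop :=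
  ∀ i j, ContDiffOn ℝ ∞ (fun y => A y i j) U

/-- The entrywise partial derivative of a matrix of functions. -/
def matDeriv (l : Fin n) (A : Coord n → Matrix (Fin n) (Fin n) ℝ) (y : Coord n) :
    Matrix (Fin n) (Fin n) ℝ :=
  Matrix.of fun i j => pderiv l (fun z => A z i j) y

variable {A B : Coord n → Matrix (Fin n) (Fin n) ℝ}

lemma SmoothMatrix.add (hA : SmoothMatrix U A) (hB : SmoothMatrix U B) :
    SmoothMatrix U (fun z => A z + B z) := fun i j => (hA i j).add (hB i j)

lemma SmoothMatrix.sub (hA : SmoothMatrix U A) (hB : SmoothMatrix U B) :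
    SmoothMatrix U (fun z => A z - B z) := fun i j => (hA i j).sub (hB i j)

lemma SmoothMatrix.mul (hA : SmoothMatrix U A) (hB : SmoothMatrix U B) :
    SmoothMatrix U (fun z => A z * B z) := fun i j => by
  simp only [Matrix.mul_apply]
  exact ContDiffOn.sum fun a _ => (hA i a).mul (hB a j)

lemma SmoothMatrix.transpose (hA : SmoothMatrix U A) :
    SmoothMatrix U (fun z => (A z).transpose) := fun i j => hA j i

lemma SmoothMatrix.det (hA : SmoothMatrix U A) : ContDiffOn ℝ ∞ (fun z => (A z).det) U := by
  simp only [Matrix.det_apply']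
  exact ContDiffOn.sum fun σ _ => contDiffOn_const.mul (contDiffOn_prod fun i _ => hA _ _)

lemma SmoothMatrix.inv (hA : SmoothMatrix U A) (hd : ∀ z ∈ U, IsUnit (A z).det) :
    SmoothMatrix U (fun z => (A z)⁻¹) := fun i j => by
  simp only [Matrix.inv_def, Matrix.smul_apply, Ring.inverse_eq_inv', smul_eq_mul,
    Matrix.adjugate_apply]
  refine (hA.det.inv fun z hz => (hd z hz).ne_zero).mul (SmoothMatrix.det fun a b => ?_)
  by_cases h : a = j
  · subst h
    simpa using contDiffOn_const
  · simpa [Matrix.updateRow_ne h] using hA a b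

lemma SmoothMatrix.matDeriv (hU : IsOpen U) (hA : SmoothMatrix U A) (l : Fin n) :
    SmoothMatrix U (matDeriv l A) := fun i j => contDiffOn_pderiv hU (hA i j) l

lemma matDeriv_add (hU : IsOpen U) (hA : SmoothMatrix U A) (hB : SmoothMatrix U B) (hy : y ∈ U)
    (l : Fin n) : matDeriv l (fun z => A z + B z) y = matDeriv l A y + matDeriv l B y := by
  ext i j
  exact pderiv_add (differentiableAt_of_contDiffOn hU (hA i j) hy)
    (differentiableAt_of_contDiffOn hU (hB i j) hy) l

lemma matDeriv_sub (hU : IsOpen U) (hA : SmoothMatrix U A) (hB : SmoothMatrix U B) (hy : y ∈ U)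
    (l : Fin n) : matDeriv l (fun z => A z - B z) y = matDeriv l A y - matDeriv l B y := by
  ext i j
  exact pderiv_sub (differentiableAt_of_contDiffOn hU (hA i j) hy)
    (differentiableAt_of_contDiffOn hU (hB i j) hy) l

lemma matDeriv_mul (hU : IsOpen U) (hA : SmoothMatrix U A) (hB : SmoothMatrix U B) (hy : y ∈ U)
    (l : Fin n) :
    matDeriv l (fun z => A z * B z) y = matDeriv l A y * B y + A y * matDeriv l B y := by
  ext i j
  have hA' := fun i j => differentiableAt_of_contDiffOn hU (hA i j) hy
  have hB' := fun i j => differentiableAt_of_contDiffOn hU (hB i j) hy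
  simp only [matDeriv, Matrix.of_apply, Matrix.add_apply, Matrix.mul_apply]
  rw [← Finset.sum_add_distrib]
  refine (pderiv_sum Finset.univ (f := fun a z => A z i a * B z a j)
    (fun a _ => (hA' i a).mul (hB' a j)) l).trans ?_
  exact Finset.sum_congr rfl fun a _ => pderiv_mul (hA' i a) (hB' a j) l

lemma matDeriv_transpose (l : Fin n) :
    matDeriv l (fun z => (A z).transpose) y = (matDeriv l A y).transpose := rfl

lemma matDeriv_congr (hU : IsOpen U) (hy : y ∈ U) (h : ∀ z ∈ U, A z = B z) (l : Fin n) :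
    matDeriv l A y = matDeriv l B y := by
  ext i j
  exact pderiv_congr hU hy (fun z hz => by rw [h z hz]) l

lemma matDeriv_comm (hU : IsOpen U) (hA : SmoothMatrix U A) (hy : y ∈ U) (j k : Fin n) :
    matDeriv j (matDeriv k A) y = matDeriv k (matDeriv j A) y := by
  ext a b
  exact pderiv_comm hU (hA a b) hy j k

/-- The curvature `∂_k A_j - ∂_j A_k + [A_j, A_k]` of the connection `∂_j - A_j`. -/
def curv (A : Fin n → Coord n → Matrix (Fin n) (Fin n) ℝ) (j k : Fin n) (y : Coord n) :
    Matrix (Fin n) (Fin n) ℝ :=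
  matDeriv k (A j) y - matDeriv j (A k) y + (A j y * A k y - A k y * A j y)

lemma smoothMatrix_curv (hU : IsOpen U) {A : Fin n → Coord n → Matrix (Fin n) (Fin n) ℝ}
    (hA : ∀ j, SmoothMatrix U (A j)) (j k : Fin n) : SmoothMatrix U (curv A j k) :=
  (((hA j).matDeriv hU k).sub ((hA k).matDeriv hU j)).add
    (((hA j).mul (hA k)).sub ((hA k).mul (hA j)))

/-- The differential Bianchi identity for a connection on a trivial bundle. -/
lemma curv_bianchi (hU : IsOpen U) {A : Fin n → Coord n → Matrix (Fin n) (Fin n) ℝ}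
    (hA : ∀ j, SmoothMatrix U (A j)) (hy : y ∈ U) (j k l : Fin n) :
    matDeriv l (curv A j k) y + matDeriv j (curv A k l) y + matDeriv k (curv A l j) y =
      (curv A j l y * A k y - A k y * curv A j l y) + (curv A k j y * A l y - A l y * curv A k j y)
        + (curv A l k y * A j y - A j y * curv A l k y) := by
  have e : ∀ j k l, matDeriv l (curv A j k) y =
      matDeriv l (matDeriv k (A j)) y - matDeriv l (matDeriv j (A k)) y
        + ((matDeriv l (A j) y * A k y + A j y * matDeriv l (A k) y)
          - (matDeriv l (A k) y * A j y + A k y * matDeriv l (A j) y)) := fun j k l => by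
    unfold curv
    rw [matDeriv_add hU (((hA j).matDeriv hU k).sub ((hA k).matDeriv hU j))
        (((hA j).mul (hA k)).sub ((hA k).mul (hA j))) hy,
      matDeriv_sub hU ((hA j).matDeriv hU k) ((hA k).matDeriv hU j) hy,
      matDeriv_sub hU ((hA j).mul (hA k)) ((hA k).mul (hA j)) hy,
      matDeriv_mul hU (hA j) (hA k) hy, matDeriv_mul hU (hA k) (hA j) hy]
  rw [e, e, e, matDeriv_comm hU (hA j) hy l k, matDeriv_comm hU (hA k) hy l j,
    matDeriv_comm hU (hA l) hy j k]
  unfold curv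
  noncomm_ring

end Calculus

/-! ### The Levi-Civita connection in coordinates -/

section LeviCivita

variable {n : ℕ} {U : Set (Coord n)} {G : Coord n → Matrix (Fin n) (Fin n) ℝ} {y : Coord n}

/-- The components of a smooth pseudo-Riemannian metric on an open subset of `ℝⁿ`. -/
structure IsSmoothMetric (U : Set (Coord n)) (G : Coord n → Matrix (Fin n) (Fin n) ℝ) : Prop where
  isOpen : IsOpen U
  smooth : SmoothMatrix U G
  symm : ∀ y ∈ U, ∀ i j, G y i j = G y j i
  det : ∀ y ∈ U, IsUnit (G y).det

namespace IsSmoothMetric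

lemma isMetric (h : IsSmoothMetric U G) (hy : y ∈ U) :
    IsMetric (fun i j => G y i j) (fun i j => (G y)⁻¹ i j) :=
  isMetric_inv (h.symm y hy) (h.det y hy)

lemma transpose_eq (h : IsSmoothMetric U G) (hy : y ∈ U) : (G y).transpose = G y :=
  Matrix.ext fun i j => h.symm y hy j i

lemma smooth_inv (h : IsSmoothMetric U G) : SmoothMatrix U fun z => (G z)⁻¹ := h.smooth.inv h.det

lemma inv_mul (h : IsSmoothMetric U G) (hy : y ∈ U) : (G y)⁻¹ * G y = 1 :=
  Matrix.nonsing_inv_mul _ (h.det y hy)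

lemma mul_inv (h : IsSmoothMetric U G) (hy : y ∈ U) : G y * (G y)⁻¹ = 1 :=
  Matrix.mul_nonsing_inv _ (h.det y hy)

lemma pderiv_symm (h : IsSmoothMetric U G) (hy : y ∈ U) (l i j : Fin n) :
    pderiv l (fun z => G z i j) y = pderiv l (fun z => G z j i) y :=
  pderiv_congr h.isOpen hy (fun z hz => h.symm z hz i j) l

end IsSmoothMetric

/-- The matrix of Christoffel symbols `Γ^a_{li}` with row `a` and column `i`. -/
def gammaMat (G : Coord n → Matrix (Fin n) (Fin n) ℝ) (l : Fin n) (y : Coord n) :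
    Matrix (Fin n) (Fin n) ℝ :=
  Matrix.of fun a i => christoffel G y a i l

namespace IsSmoothMetric

lemma christoffel_symm (h : IsSmoothMetric U G) (hy : y ∈ U) (a i j : Fin n) :
    christoffel G y a i j = christoffel G y a j i := by
  unfold christoffel
  congr 1
  refine Finset.sum_congr rfl fun b _ => ?_
  rw [h.pderiv_symm hy b i j]
  ring

lemma smooth_gammaMat (h : IsSmoothMetric U G) (l : Fin n) : SmoothMatrix U (gammaMat G l) := by
  intro a i
  have hp := fun k i j => contDiffOn_pderiv h.isOpen (h.smooth i j) k
  simp only [gammaMat, Matrix.of_apply, christoffel]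
  exact contDiffOn_const.mul (ContDiffOn.sum fun b _ => (h.smooth_inv a b).mul
    (((hp i b l).add (hp l b i)).sub (hp b i l)))

/-- The Levi-Civita connection is metric. -/
lemma matDeriv_metric (h : IsSmoothMetric U G) (hy : y ∈ U) (l : Fin n) :
    matDeriv l G y = (gammaMat G l y).transpose * G y + G y * gammaMat G l y := by
  have e : ∀ c i, (G y * gammaMat G l y) c i = (1 / 2) * (pderiv i (fun z => G z c l) y
      + pderiv l (fun z => G z c i) y - pderiv c (fun z => G z i l) y) := fun c i => by
    obtain ⟨v, hv⟩ : ∃ v : Fin n → ℝ, v = fun b => (pderiv i (fun z => G z b l) y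
      + pderiv l (fun z => G z b i) y - pderiv b (fun z => G z i l) y) := ⟨_, rfl⟩
    have e1 : (fun a => gammaMat G l y a i) = (1 / 2 : ℝ) • ((G y)⁻¹).mulVec v := by
      funext a
      rw [hv]
      rfl
    have e2 : (G y).mulVec (fun a => gammaMat G l y a i) = (1 / 2 : ℝ) • v := by
      rw [e1, Matrix.mulVec_smul, Matrix.mulVec_mulVec, h.mul_inv hy, Matrix.one_mulVec]
    have e3 := congrFun e2 c
    rw [hv] at e3
    exact e3
  have e' : (gammaMat G l y).transpose * G y = (G y * gammaMat G l y).transpose := by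
    rw [Matrix.transpose_mul, h.transpose_eq hy]
  ext i j
  rw [e', Matrix.add_apply, Matrix.transpose_apply, e, e, h.pderiv_symm hy l j i,
    h.pderiv_symm hy i j l, h.pderiv_symm hy j i l]
  simp only [matDeriv, Matrix.of_apply]
  ring

lemma matDeriv_inv (h : IsSmoothMetric U G) (hy : y ∈ U) (l : Fin n) :
    matDeriv l (fun z => (G z)⁻¹) y
      = - ((G y)⁻¹ * (gammaMat G l y).transpose + gammaMat G l y * (G y)⁻¹) := by
  have e := matDeriv_mul h.isOpen h.smooth_inv h.smooth hy l
  have e0 : matDeriv l (fun z => (G z)⁻¹ * G z) y = 0 := by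
    rw [matDeriv_congr h.isOpen hy (B := fun _ => 1) (fun z hz => h.inv_mul hz)]
    ext i j
    exact pderiv_const _ _
  rw [e0, h.matDeriv_metric hy] at e
  have e1 := congrArg (· * (G y)⁻¹) e
  simp only [Matrix.zero_mul, Matrix.add_mul, Matrix.mul_add, Matrix.mul_assoc, h.mul_inv hy,
    Matrix.mul_one] at e1
  rw [← Matrix.mul_assoc (G y)⁻¹ (G y), h.inv_mul hy, Matrix.one_mul] at e1
  rw [eq_neg_iff_add_eq_zero]
  exact e1.symm

/-! ### Symmetries of the curvature tensor -/

lemma riemannUp_eq (h : IsSmoothMetric U G) (hy : y ∈ U) (m i j k : Fin n) :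
    riemannUp G y m i j k = (matDeriv j (gammaMat G k) y - matDeriv k (gammaMat G j) y
      + (gammaMat G j y * gammaMat G k y - gammaMat G k y * gammaMat G j y)) m i := by
  simp only [Matrix.add_apply, Matrix.sub_apply, Matrix.mul_apply, ← Finset.sum_sub_distrib]
  unfold riemannUp
  congr 1
  refine Finset.sum_congr rfl fun a _ => ?_
  rw [h.christoffel_symm hy m j a, h.christoffel_symm hy m k a]
  rfl

lemma riemannUp_bianchi (h : IsSmoothMetric U G) (hy : y ∈ U) (m i j k : Fin n) :
    riemannUp G y m i j k + riemannUp G y m j k i + riemannUp G y m k i j = 0 := by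
  have e : ∀ l i j, pderiv l (fun z => christoffel G z m i j) y
      = pderiv l (fun z => christoffel G z m j i) y := fun l i j =>
    pderiv_congr h.isOpen hy (fun z hz => h.christoffel_symm hz m i j) l
  simp only [riemannUp, Finset.sum_sub_distrib]
  rw [e j k i, e k j i, e i k j]
  have s : ∀ a i j, christoffel G y a i j = christoffel G y a j i :=
    fun a i j => h.christoffel_symm hy a i j
  simp only [s _ k i, s _ j i, s _ k j]
  ring

lemma riemann_antisymm (h : IsSmoothMetric U G) (hy : y ∈ U) (l i j k : Fin n) :
    riemann G y i l j k = - riemann G y l i j k := by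
  obtain ⟨R, hR⟩ : ∃ R, R = matDeriv j (gammaMat G k) y - matDeriv k (gammaMat G j) y
      + (gammaMat G j y * gammaMat G k y - gammaMat G k y * gammaMat G j y) := ⟨_, rfl⟩
  have e : ∀ l i, riemann G y l i j k = (G y * R) l i := fun l i => by
    simp only [riemann, Matrix.mul_apply, h.riemannUp_eq hy, hR]
  have hs := h.smooth
  have hΓ := h.smooth_gammaMat
  have hU := h.isOpen
  have d : ∀ j k, matDeriv j (matDeriv k G) y = (matDeriv j (gammaMat G k) y).transpose * G y
      + (gammaMat G k y).transpose * ((gammaMat G j y).transpose * G y + G y * gammaMat G j y)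
      + (((gammaMat G j y).transpose * G y + G y * gammaMat G j y) * gammaMat G k y
      + G y * matDeriv j (gammaMat G k) y) := fun j k => by
    rw [matDeriv_congr hU hy (fun z hz => h.matDeriv_metric hz k),
      matDeriv_add hU ((hΓ k).transpose.mul hs) (hs.mul (hΓ k)) hy,
      matDeriv_mul hU (hΓ k).transpose hs hy, matDeriv_mul hU hs (hΓ k) hy,
      matDeriv_transpose, h.matDeriv_metric hy]
  have key : G y * R + (G y * R).transpose = 0 := by
    have c := matDeriv_comm hU hs hy j k
    rw [d, d, ← sub_eq_zero] at c
    rw [Matrix.transpose_mul, h.transpose_eq hy, hR, ← c]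
    simp only [Matrix.transpose_add, Matrix.transpose_sub, Matrix.transpose_mul]
    noncomm_ring
  have := congrFun₂ key i l
  rw [e, e]
  simp only [Matrix.add_apply, Matrix.transpose_apply, Matrix.zero_apply] at this
  linarith

lemma isCurvature_riemann (h : IsSmoothMetric U G) (hy : y ∈ U) : IsCurvature (riemann G y) := by
  refine ⟨fun l i j k => h.riemann_antisymm hy l i j k, fun l i j k => ?_, fun l i j k => ?_⟩
  · simp only [riemann, ← Finset.sum_neg_distrib]
    refine Finset.sum_congr rfl fun m _ => ?_
    simp only [riemannUp, Finset.sum_sub_distrib]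
    ring
  · simp only [riemann, ← Finset.sum_add_distrib, ← mul_add, h.riemannUp_bianchi hy, mul_zero,
      Finset.sum_const_zero]

end IsSmoothMetric

end LeviCivita

/-! ### The covariant derivative of the structure tensor -/

section Covariant

variable {n : ℕ} {U : Set (Coord n)} {G : Coord n → Matrix (Fin n) (Fin n) ℝ} {y : Coord n}

/-- The contraction `Γ^a_{li} f_a`. -/
def gammaAct (G : Coord n → Matrix (Fin n) (Fin n) ℝ) (y : Coord n) (l i : Fin n)
    (f : Fin n → ℝ) : ℝ := ∑ a, christoffel G y a l i * f a

lemma gammaAct_add (l i : Fin n) (f g : Fin n → ℝ) :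
    gammaAct G y l i (fun a => f a + g a) = gammaAct G y l i f + gammaAct G y l i g := by
  simp [gammaAct, mul_add, Finset.sum_add_distrib]

lemma gammaAct_sub (l i : Fin n) (f g : Fin n → ℝ) :
    gammaAct G y l i (fun a => f a - g a) = gammaAct G y l i f - gammaAct G y l i g := by
  simp [gammaAct, mul_sub, Finset.sum_sub_distrib]

lemma gammaAct_mul_const (l i : Fin n) (f : Fin n → ℝ) (c : ℝ) :
    gammaAct G y l i (fun a => f a * c) = gammaAct G y l i f * c := by
  simp [gammaAct, Finset.sum_mul, mul_assoc]

lemma gammaAct_const_mul (l i : Fin n) (f : Fin n → ℝ) (c : ℝ) :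
    gammaAct G y l i (fun a => c * f a) = c * gammaAct G y l i f := by
  simp_rw [mul_comm c, gammaAct_mul_const]

lemma covDeriv3_eq (A : Coord n → Tensor3 n) (i j k l : Fin n) :
    covDeriv3 G A y i j k l = pderiv l (fun z => A z i j k) y
      - (gammaAct G y l i (fun a => A y a j k) + gammaAct G y l j (fun a => A y i a k)
        + gammaAct G y l k (fun a => A y i j a)) := by
  simp [covDeriv3, gammaAct, Finset.sum_add_distrib]

namespace IsSmoothMetric

lemma pderiv_metric (h : IsSmoothMetric U G) (hy : y ∈ U) (l i j : Fin n) :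
    pderiv l (fun z => G z i j) y
      = gammaAct G y l i (fun a => G y a j) + gammaAct G y l j (fun a => G y i a) := by
  have e := congrFun₂ (h.matDeriv_metric hy l) i j
  simp only [matDeriv, Matrix.of_apply, Matrix.add_apply, Matrix.mul_apply,
    Matrix.transpose_apply, gammaMat] at e
  rw [e]
  congr 1
  · exact Finset.sum_congr rfl fun a _ => by rw [h.christoffel_symm hy a l i]
  · exact Finset.sum_congr rfl fun a _ => by rw [h.christoffel_symm hy a l j, mul_comm]

/-- The covariant derivative respects the splitting into harmonic part and trace, because the metric
is parallel. -/
lemma covDeriv3_assemble (h : IsSmoothMetric U G) (hy : y ∈ U) {T S : Coord n → Tensor3 n}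
    {s : Coord n → Fin n → ℝ} (hS : ∀ i j k, ContDiffOn ℝ ∞ (fun z => S z i j k) U)
    (hs : ∀ i, ContDiffOn ℝ ∞ (fun z => s z i) U)
    (hT : ∀ z ∈ U, T z = assemble (fun i j => G z i j) (S z) (s z)) (i j k l : Fin n) :
    covDeriv3 G T y i j k l = assemble (fun i j => G y i j) (fun i j k => covDeriv3 G S y i j k l)
      (fun j => pderiv l (fun z => s z j) y - gammaAct G y l j (s y)) i j k := by
  have dS := fun i j k => differentiableAt_of_contDiffOn h.isOpen (hS i j k) hy
  have ds := fun i => differentiableAt_of_contDiffOn h.isOpen (hs i) hy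
  have dG := fun i j => differentiableAt_of_contDiffOn h.isOpen (h.smooth i j) hy
  obtain ⟨g, hg⟩ : ∃ g : Coord n → Tensor2 n, ∀ z i j, G z i j = g z i j := ⟨G, fun _ _ _ => rfl⟩
  have hp := h.pderiv_metric hy
  have e : pderiv l (fun z => T z i j k) y = pderiv l (fun z => S z i j k) y
      + (pderiv l (fun z => G z i k) y * s y j + G y i k * pderiv l (fun z => s z j) y)
      + (pderiv l (fun z => G z j k) y * s y i + G y j k * pderiv l (fun z => s z i) y)
      - 2 / (n : ℝ) * (pderiv l (fun z => G z i j) y * s y k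
        + G y i j * pderiv l (fun z => s z k) y) := by
    have e0 : pderiv l (fun z => T z i j k) y = pderiv l (fun z => S z i j k + G z i k * s z j
        + G z j k * s z i - 2 / (n : ℝ) * (G z i j * s z k)) y :=
      pderiv_congr h.isOpen hy (fun z hz => by rw [hT z hz]; rfl) l
    rw [e0, pderiv_sub (((dS i j k).fun_add ((dG i k).fun_mul (ds j))).fun_add
        ((dG j k).fun_mul (ds i))) (((dG i j).fun_mul (ds k)).const_mul _),
      pderiv_add ((dS i j k).fun_add ((dG i k).fun_mul (ds j))) ((dG j k).fun_mul (ds i)),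
      pderiv_add (dS i j k) ((dG i k).fun_mul (ds j)), pderiv_const_mul ((dG i j).fun_mul (ds k)),
      pderiv_mul (dG i k) (ds j), pderiv_mul (dG j k) (ds i), pderiv_mul (dG i j) (ds k)]
  rw [covDeriv3_eq, e, hp, hp, hp, hT y hy]
  simp only [hg, assemble, covDeriv3_eq, gammaAct_add, gammaAct_sub, gammaAct_mul_const,
    gammaAct_const_mul]
  ring

/-- Trace-freeness passes to the covariant derivative, because the metric is parallel. -/
lemma contr_covDeriv3_eq_zero (h : IsSmoothMetric U G) (hy : y ∈ U) {A : Coord n → Tensor3 n}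
    (hA : ∀ i j k, ContDiffOn ℝ ∞ (fun z => A z i j k) U)
    (h0 : ∀ z ∈ U, ∀ k, contr (fun i j => (G z)⁻¹ i j) (fun i j => A z i j k) = 0)
    (k l : Fin n) :
    contr (fun i j => (G y)⁻¹ i j) (fun i j => covDeriv3 G A y i j k l) = 0 := by
  obtain ⟨B, hB⟩ : ∃ B : Coord n → Matrix (Fin n) (Fin n) ℝ, B = fun z =>
    Matrix.of fun i j => A z i j k := ⟨_, rfl⟩
  have sB : SmoothMatrix U B := fun i j => by rw [hB]; exact hA i j k
  have tr : ∀ (z : Coord n) (M : Matrix (Fin n) (Fin n) ℝ),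
      contr (fun i j => (G z)⁻¹ i j) (fun i j => M i j) = ((G z)⁻¹ * M.transpose).trace :=
    fun z M => rfl
  have e1 : (matDeriv l (fun z => (G z)⁻¹ * (B z).transpose) y).trace = 0 := by
    have sM := h.smooth_inv.mul sB.transpose
    have e2 : pderiv l (fun z => ∑ i, ((G z)⁻¹ * (B z).transpose) i i) y = 0 := by
      rw [pderiv_congr h.isOpen hy (g := fun _ => 0) (fun z hz => ?_), pderiv_const]
      have := h0 z hz k
      rw [hB]
      exact this
    rw [pderiv_sum _ fun i _ => differentiableAt_of_contDiffOn h.isOpen (sM i i) hy] at e2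
    exact e2
  rw [matDeriv_mul h.isOpen h.smooth_inv sB.transpose hy, h.matDeriv_inv hy,
    matDeriv_transpose] at e1
  have e3 : (fun i j => covDeriv3 G A y i j k l) = fun i j =>
      (matDeriv l B y - ((gammaMat G l y).transpose * B y + B y * gammaMat G l y)) i j
        - gammaAct G y l k (fun a => A y i j a) := by
    funext i j
    rw [covDeriv3_eq]
    have a1 : gammaAct G y l i (fun a => A y a j k) = ((gammaMat G l y).transpose * B y) i j := by
      rw [Matrix.mul_apply, hB]
      exact Finset.sum_congr rfl fun a _ => by rw [h.christoffel_symm hy a l i]; rfl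
    have a2 : gammaAct G y l j (fun a => A y i a k) = (B y * gammaMat G l y) i j := by
      rw [Matrix.mul_apply, hB]
      exact Finset.sum_congr rfl fun a _ => by
        rw [h.christoffel_symm hy a l j, mul_comm]; rfl
    have a3 : pderiv l (fun z => A z i j k) y = matDeriv l B y i j := by rw [hB]; rfl
    rw [a1, a2, a3, Matrix.sub_apply, Matrix.add_apply]
    ring
  have e4 : contr (fun i j => (G y)⁻¹ i j) (fun i j => gammaAct G y l k (fun a => A y i j a))
      = 0 := by
    have a1 : contr (fun i j => (G y)⁻¹ i j) (fun i j => gammaAct G y l k (fun a => A y i j a))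
        = gammaAct G y l k
          (fun a => contr (fun i j => (G y)⁻¹ i j) (fun i j => A y i j a)) := by
      simp only [contr, gammaAct, Finset.mul_sum]
      refine ((Finset.sum_congr rfl fun i _ => Finset.sum_comm).trans Finset.sum_comm).trans ?_
      exact Finset.sum_congr rfl fun a _ => Finset.sum_congr rfl fun i _ =>
        Finset.sum_congr rfl fun j _ => by ring
    rw [a1]
    simp [gammaAct, h0 y hy]
  rw [e3]
  refine (contr_sub (H := fun i j => (G y)⁻¹ i j) (fun i j => (matDeriv l B y
    - ((gammaMat G l y).transpose * B y + B y * gammaMat G l y)) i j) _).trans ?_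
  rw [e4, sub_zero, tr]
  rw [Matrix.trace_add, Matrix.neg_mul, Matrix.trace_neg, Matrix.add_mul, Matrix.trace_add,
    Matrix.mul_assoc (gammaMat G l y), Matrix.trace_mul_comm (gammaMat G l y)] at e1
  rw [Matrix.transpose_sub, Matrix.transpose_add, Matrix.transpose_mul, Matrix.transpose_mul,
    Matrix.transpose_transpose, Matrix.mul_sub, Matrix.mul_add, Matrix.trace_sub,
    Matrix.trace_add]
  simp only [Matrix.mul_assoc] at e1 ⊢
  linarith

lemma isHarmonic_covDeriv3 (h : IsSmoothMetric U G) (hy : y ∈ U) {S : Coord n → Tensor3 n}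
    (sS : ∀ i j k, ContDiffOn ℝ ∞ (fun z => S z i j k) U)
    (hS : ∀ z ∈ U, IsHarmonic (fun i j => (G z)⁻¹ i j) (S z)) (l : Fin n) :
    IsHarmonic (fun i j => (G y)⁻¹ i j) fun i j k => covDeriv3 G S y i j k l := by
  refine ⟨fun i j k => ?_, fun i j k => ?_,
    fun k => h.contr_covDeriv3_eq_zero hy sS (fun z hz => (hS z hz).trace) k l⟩
  · rw [covDeriv3_eq, covDeriv3_eq,
      pderiv_congr h.isOpen hy (fun z hz => (hS z hz).symm₁₂ i j k)]
    simp only [(hS y hy).symm₁₂ i, fun a => (hS y hy).symm₁₂ a j k]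
    ring
  · rw [covDeriv3_eq, covDeriv3_eq,
      pderiv_congr h.isOpen hy (fun z hz => (hS z hz).symm₂₃ i j k)]
    simp only [fun a => (hS y hy).symm₂₃ a j k, fun a => (hS y hy).symm₂₃ i a k,
      fun a => (hS y hy).symm₂₃ i j a]
    ring

/-- Under the first condition on an open set, the second integrability condition at a point is
equivalent to the Weyl condition together with the differential condition. -/
theorem quadraticConditionAt_iff (h : IsSmoothMetric U G) (hn : 3 ≤ n) {T : Coord n → Tensor3 n}
    (sT : ∀ i j k, ContDiffOn ℝ ∞ (fun z => T z i j k) U)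
    (hT : ∀ z ∈ U, StructureSymmetriesAt G T z) (hI : ∀ z ∈ U, LinearConditionAt G T z)
    (hy : y ∈ U) :
    QuadraticConditionAt G T y ↔ WeylConditionAt G T y ∧ DifferentialConditionAt G T y := by
  have hS : ∀ z ∈ U, IsHarmonic (fun i j => (G z)⁻¹ i j) (tRing G T z) ∧
      T z = assemble (fun i j => G z i j) (tRing G T z) (tBar G T z) := fun z hz => by
    obtain ⟨S, hS, e⟩ := exists_harmonic hn (h.isMetric hz) (hT z hz) (hI z hz)
    rw [tRing_eq hn (h.isMetric hz) hS e]
    exact ⟨hS, e⟩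
  have ss : ∀ i, ContDiffOn ℝ ∞ (fun z => tBar G T z i) U := fun i =>
    contDiffOn_const.mul (ContDiffOn.sum fun j _ => ContDiffOn.sum fun a _ =>
      (h.smooth_inv j a).mul (sT i j a))
  have sS : ∀ i j k, ContDiffOn ℝ ∞ (fun z => tRing G T z i j k) U := fun i j k => by
    refine ContDiffOn.congr (f := fun z => T z i j k - G z i k * tBar G T z j
      - G z j k * tBar G T z i + 2 / (n : ℝ) * (G z i j * tBar G T z k)) ?_ fun z hz => ?_
    · exact (((sT i j k).sub ((h.smooth i k).mul (ss j))).sub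
        ((h.smooth j k).mul (ss i))).add (contDiffOn_const.mul ((h.smooth i j).mul (ss k)))
    · have e := congrFun (congrFun₂ (hS z hz).2 i j) k
      simp only [e, assemble]
      ring
  exact SIC.quadraticConditionAt_iff hn (h.isMetric hy) (hS y hy).1 (hS y hy).2
    (fun l => h.isHarmonic_covDeriv3 hy sS (fun z hz => (hS z hz).1) l)
    (P := fun j l => pderiv l (fun z => tBar G T z j) y - gammaAct G y l j (tBar G T y))
    (fun i j k l => h.covDeriv3_assemble hy sS ss (fun z hz => (hS z hz).2) i j k l)
    (h.isCurvature_riemann hy)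

end IsSmoothMetric

end Covariant

/-! ### The third integrability condition -/

section Cubic

variable {n : ℕ} {U : Set (Coord n)} {G : Coord n → Matrix (Fin n) (Fin n) ℝ}
  {T : Coord n → Tensor3 n} {y : Coord n}

/-- The matrix `T_{ijp}` with row `i` and column `p`. -/
def structMat (T : Coord n → Tensor3 n) (j : Fin n) (z : Coord n) : Matrix (Fin n) (Fin n) ℝ :=
  Matrix.of fun i p => T z i j p

/-- The connection matrices `A_j = g⁻¹ T_j - Γ_j` of the prolongation: the gradient `V^i` of a
solution `V` satisfies `∂_j V^i = (A_j)^i_p V^p + δ^i_j ΔV / n`. -/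
def prolongMat (G : Coord n → Matrix (Fin n) (Fin n) ℝ) (T : Coord n → Tensor3 n) (j : Fin n)
    (z : Coord n) : Matrix (Fin n) (Fin n) ℝ :=
  (G z)⁻¹ * structMat T j z - gammaMat G j z

namespace IsSmoothMetric

lemma smooth_prolongMat (h : IsSmoothMetric U G)
    (sT : ∀ i j k, ContDiffOn ℝ ∞ (fun z => T z i j k) U) (j : Fin n) :
    SmoothMatrix U (prolongMat G T j) :=
  (h.smooth_inv.mul (show SmoothMatrix U (structMat T j) from fun i p => sT i j p)).sub
    (h.smooth_gammaMat j)

/-- The first condition, with the first index raised. -/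
lemma prolongMat_linear (h : IsSmoothMetric U G) (hy : y ∈ U) (hI : LinearConditionAt G T y)
    (i j k : Fin n) :
    prolongMat G T j y i k + 1 / ((n : ℝ) - 1) * ((if i = j then 1 else 0) * tTrace G T y k)
      = prolongMat G T k y i j + 1 / ((n : ℝ) - 1) * ((if i = k then 1 else 0) * tTrace G T y j)
    := by
  have hG := h.isMetric hy
  have e1 : ∀ j k, ∑ a, (G y)⁻¹ i a * (T y a j k + 1 / ((n : ℝ) - 1) * G y a j * tTrace G T y k)
      = ((G y)⁻¹ * structMat T j y) i k
        + 1 / ((n : ℝ) - 1) * ((if i = j then 1 else 0) * tTrace G T y k) := fun j k => by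
    rw [← hG.sum_inv_mul i j, Matrix.mul_apply, Finset.sum_mul, Finset.mul_sum,
      ← Finset.sum_add_distrib]
    exact Finset.sum_congr rfl fun a _ => by simp only [structMat, Matrix.of_apply]; ring
  have e : ∑ a, (G y)⁻¹ i a * (T y a j k + 1 / ((n : ℝ) - 1) * G y a j * tTrace G T y k)
      - ∑ a, (G y)⁻¹ i a * (T y a k j + 1 / ((n : ℝ) - 1) * G y a k * tTrace G T y j) = 0 := by
    rw [← Finset.sum_sub_distrib]
    exact Finset.sum_eq_zero fun a _ => by rw [← mul_sub, hI a j k, mul_zero]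
  rw [e1, e1] at e
  have e2 : gammaMat G j y i k = gammaMat G k y i j := h.christoffel_symm hy i k j
  have e3 : ∀ j k, prolongMat G T j y i k = ((G y)⁻¹ * structMat T j y) i k - gammaMat G j y i k :=
    fun _ _ => rfl
  rw [e3, e3, e2]
  linear_combination e

/-- The second condition, with the first index raised: the curvature of the prolongation connection
is a pure trace. -/
lemma curv_prolongMat (h : IsSmoothMetric U G) (hy : y ∈ U)
    (sT : ∀ i j k, ContDiffOn ℝ ∞ (fun z => T z i j k) U) (hII : QuadraticConditionAt G T y)
    (i j k m : Fin n) :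
    curv (prolongMat G T) j k y i m = - (1 / ((n : ℝ) - 1)) *
      ((if i = j then 1 else 0) * tensorq G T y k m - (if i = k then 1 else 0) * tensorq G T y j m)
    := by
  have hG := h.isMetric hy
  have sM : ∀ j, SmoothMatrix U (structMat T j) := fun j i p => sT i j p
  obtain ⟨R, hR⟩ : ∃ R, R = matDeriv j (gammaMat G k) y - matDeriv k (gammaMat G j) y
      + (gammaMat G j y * gammaMat G k y - gammaMat G k y * gammaMat G j y) := ⟨_, rfl⟩
  have hGR : ∀ a, riemann G y a m j k = (G y * R) a m := fun a => by
    simp only [riemann, Matrix.mul_apply, h.riemannUp_eq hy, hR]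
  obtain ⟨D, hD⟩ : ∃ D : Fin n → Fin n → Matrix (Fin n) (Fin n) ℝ, ∀ j k, D j k =
    matDeriv k (structMat T j) y - (gammaMat G k y).transpose * structMat T j y
      - structMat T j y * gammaMat G k y := ⟨_, fun _ _ => rfl⟩
  -- up to a term symmetric in `j` and `k`, the covariant derivative of `T` is a matrix expression
  have hD' : ∀ j k a, covDeriv3 G T y a j m k = D j k a m
      - gammaAct G y k j (fun b => T y a b m) := fun j k a => by
    have a1 : gammaAct G y k a (fun b => T y b j m)
        = ((gammaMat G k y).transpose * structMat T j y) a m := by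
      rw [Matrix.mul_apply]
      exact Finset.sum_congr rfl fun b _ => by rw [h.christoffel_symm hy b k a]; rfl
    have a2 : gammaAct G y k m (fun b => T y a j b) = (structMat T j y * gammaMat G k y) a m := by
      rw [Matrix.mul_apply]
      exact Finset.sum_congr rfl fun b _ => by rw [h.christoffel_symm hy b k m, mul_comm]; rfl
    have a3 : pderiv k (fun z => T z a j m) y = matDeriv k (structMat T j) y a m := rfl
    rw [covDeriv3_eq, a1, a2, a3, hD, Matrix.sub_apply, Matrix.sub_apply]
    ring
  have hΓ : ∀ a, gammaAct G y k j (fun b => T y a b m) = gammaAct G y j k (fun b => T y a b m) :=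
    fun a => Finset.sum_congr rfl fun b _ => by rw [h.christoffel_symm hy b k j]
  have hTT : ∀ j k a, ∑ b, ∑ c, (G y)⁻¹ b c * T y a j b * T y c k m
      = (structMat T j y * ((G y)⁻¹ * structMat T k y)) a m := fun j k a => by
    simp only [Matrix.mul_apply, Finset.mul_sum]
    exact Finset.sum_congr rfl fun b _ => Finset.sum_congr rfl fun c _ => by
      simp only [structMat, Matrix.of_apply]; ring
  obtain ⟨L, hL⟩ : ∃ L : Matrix (Fin n) (Fin n) ℝ, L = D j k - D k j
      + (structMat T j y * ((G y)⁻¹ * structMat T k y)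
        - structMat T k y * ((G y)⁻¹ * structMat T j y)) + G y * R := ⟨_, rfl⟩
  have hL' : ∀ a, L a m = - (1 / ((n : ℝ) - 1)) *
      (G y a j * tensorq G T y k m - G y a k * tensorq G T y j m) := fun a => by
    have e := hII a j k m
    have hB := (h.isCurvature_riemann hy).bianchi a j k m
    have hA := (h.isCurvature_riemann hy).antisymm₃₄ a k j m
    simp only [tensorQ, hD', hTT, hΓ] at e
    rw [hL, Matrix.add_apply, Matrix.add_apply, Matrix.sub_apply, Matrix.sub_apply, ← hGR a]
    linear_combination e + hB - hA
  have hc : curv (prolongMat G T) j k y = (G y)⁻¹ * L := by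
    have sU : ∀ j, SmoothMatrix U fun z => (G z)⁻¹ * structMat T j z := fun j =>
      h.smooth_inv.mul (sM j)
    have e : ∀ j k, matDeriv k (prolongMat G T j) y
        = - ((G y)⁻¹ * (gammaMat G k y).transpose + gammaMat G k y * (G y)⁻¹) * structMat T j y
          + (G y)⁻¹ * matDeriv k (structMat T j) y - matDeriv k (gammaMat G j) y := fun j k => by
      unfold prolongMat
      rw [matDeriv_sub h.isOpen (sU j) (h.smooth_gammaMat j) hy,
        matDeriv_mul h.isOpen h.smooth_inv (sM j) hy, h.matDeriv_inv hy]
    have e' : (G y)⁻¹ * (G y * R) = R := by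
      rw [← Matrix.mul_assoc, h.inv_mul hy, Matrix.one_mul]
    rw [curv, e, e, hL, Matrix.mul_add _ _ (G y * R), e', hR, hD, hD]
    unfold prolongMat
    noncomm_ring
  rw [hc, Matrix.mul_apply]
  simp only [hL']
  rw [← hG.sum_inv_mul i j, ← hG.sum_inv_mul i k, Finset.sum_mul, Finset.sum_mul,
    ← Finset.sum_sub_distrib, Finset.mul_sum]
  exact Finset.sum_congr rfl fun a _ => by ring

/-- The antisymmetrisation of the third condition, with the connection matrices. -/
lemma cubicTerm_sub (h : IsSmoothMetric U G) (hy : y ∈ U) (k l p : Fin n) :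
    cubicTerm G T y k l p - cubicTerm G T y l k p =
      pderiv l (fun z => tensorq G T z k p) y - pderiv k (fun z => tensorq G T z l p) y
      + ∑ b, (tensorq G T y k b * prolongMat G T l y b p
        - tensorq G T y l b * prolongMat G T k y b p)
      + 1 / ((n : ℝ) - 1) * (tTrace G T y k * tensorq G T y l p
        - tTrace G T y l * tensorq G T y k p) := by
  have hG := h.isMetric hy
  have e : ∀ k l, cubicTerm G T y k l p = pderiv l (fun z => tensorq G T z k p) y
      - ∑ a, christoffel G y a l k * tensorq G T y a p
      + ∑ b, tensorq G T y k b * prolongMat G T l y b p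
      + 1 / ((n : ℝ) - 1) * tTrace G T y k * tensorq G T y l p := fun k l => by
    have e1 : ∑ m, ∑ b, (G y)⁻¹ m b * T y m l p * tensorq G T y k b
        = ∑ b, tensorq G T y k b * ((G y)⁻¹ * structMat T l y) b p := by
      rw [Finset.sum_comm]
      refine Finset.sum_congr rfl fun b _ => ?_
      rw [Matrix.mul_apply, Finset.mul_sum]
      refine Finset.sum_congr rfl fun m _ => ?_
      have e0 : (G y)⁻¹ m b = (G y)⁻¹ b m := hG.inv_symm m b
      rw [e0]
      simp only [structMat, Matrix.of_apply]
      ring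
    have e2 : ∑ a, christoffel G y a l p * tensorq G T y k a
        = ∑ a, tensorq G T y k a * gammaMat G l y a p :=
      Finset.sum_congr rfl fun a _ => by rw [h.christoffel_symm hy a l p, mul_comm]; rfl
    simp only [cubicTerm, covDeriv2, Finset.sum_add_distrib, e1, e2, prolongMat,
      Matrix.sub_apply, mul_sub, Finset.sum_sub_distrib]
    ring
  have e3 : ∑ a, christoffel G y a l k * tensorq G T y a p
      = ∑ a, christoffel G y a k l * tensorq G T y a p :=
    Finset.sum_congr rfl fun a _ => by rw [h.christoffel_symm hy a l k]
  rw [e, e, e3, Finset.sum_sub_distrib]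
  ring

/-- The first two conditions imply the third: it is row `j` of the Bianchi identity for the indices
`j, k, l` and the curvature of the prolongation connection, with `j` different from `k` and `l`. -/
theorem cubicConditionAt (h : IsSmoothMetric U G) (hn : 3 ≤ n)
    (sT : ∀ i j k, ContDiffOn ℝ ∞ (fun z => T z i j k) U)
    (hI : ∀ z ∈ U, LinearConditionAt G T z) (hII : ∀ z ∈ U, QuadraticConditionAt G T z)
    (hy : y ∈ U) : CubicConditionAt G T y := by
  intro k l p
  by_cases hkl : k = l
  · rw [hkl, sub_self]
  have hn' : (3 : ℝ) ≤ n := by exact_mod_cast hn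
  have h1 : (n : ℝ) - 1 ≠ 0 := by linarith
  -- dimension at least three leaves room for a third index
  obtain ⟨j, hj⟩ : ∃ j, j ∉ ({k, l} : Finset (Fin n)) := by
    by_contra! hc
    have := Finset.card_le_card (fun j _ => hc j : (Finset.univ : Finset (Fin n)) ⊆ {k, l})
    have h2 := Finset.card_le_two (a := k) (b := l)
    rw [Finset.card_univ, Fintype.card_fin] at this
    omega
  have hjk : j ≠ k := fun e => hj (by simp [e])
  have hjl : j ≠ l := fun e => hj (by simp [e])
  have sA := h.smooth_prolongMat sT
  have sF : ∀ j k, SmoothMatrix U (curv (prolongMat G T) j k) := smoothMatrix_curv h.isOpen sA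
  have hF : ∀ z ∈ U, ∀ i j k m, curv (prolongMat G T) j k z i m = - (1 / ((n : ℝ) - 1)) *
      ((if i = j then 1 else 0) * tensorq G T z k m
        - (if i = k then 1 else 0) * tensorq G T z j m) := fun z hz i j k m =>
    h.curv_prolongMat hz sT (hII z hz) i j k m
  have dF := fun j k i m => differentiableAt_of_contDiffOn h.isOpen (sF j k i m) hy
  -- the derivatives of `q` can be read off from those of the curvature
  have hq : ∀ k l : Fin n, j ≠ k → matDeriv l (curv (prolongMat G T) j k) y j p
      = - (1 / ((n : ℝ) - 1)) * pderiv l (fun z => tensorq G T z k p) y := fun k l hjk => by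
    have e : pderiv l (fun z => tensorq G T z k p) y
        = pderiv l (fun z => - ((n : ℝ) - 1) * curv (prolongMat G T) j k z j p) y :=
      pderiv_congr h.isOpen hy (fun z hz => by
        rw [hF z hz, if_pos rfl, if_neg hjk]
        field_simp
        ring) l
    rw [e, pderiv_const_mul (dF j k j p)]
    simp only [matDeriv, Matrix.of_apply]
    field_simp
  have hq' : matDeriv k (curv (prolongMat G T) l j) y j p
      = 1 / ((n : ℝ) - 1) * pderiv k (fun z => tensorq G T z l p) y := by
    have e : matDeriv k (curv (prolongMat G T) l j) y j p
        = pderiv k (fun z => -1 * curv (prolongMat G T) j l z j p) y :=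
      pderiv_congr h.isOpen hy (fun z hz => by rw [hF z hz, hF z hz]; ring) k
    have e' := hq l k hjl
    simp only [matDeriv, Matrix.of_apply] at e'
    rw [e, pderiv_const_mul (dF j l j p), e']
    ring
  have h0 : matDeriv j (curv (prolongMat G T) k l) y j p = 0 :=
    (pderiv_congr h.isOpen hy (g := fun _ => 0) (fun z hz => by
      rw [hF z hz, if_neg hjk, if_neg hjl]; ring) j).trans (pderiv_const _ _)
  have comm : ∀ i k m, (curv (prolongMat G T) i k y * prolongMat G T m y
      - prolongMat G T m y * curv (prolongMat G T) i k y) j p = - (1 / ((n : ℝ) - 1)) *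
      ((if j = i then 1 else 0) * ∑ b, tensorq G T y k b * prolongMat G T m y b p
        - (if j = k then 1 else 0) * ∑ b, tensorq G T y i b * prolongMat G T m y b p
        - (prolongMat G T m y j i * tensorq G T y k p
          - prolongMat G T m y j k * tensorq G T y i p)) := fun i k m => by
    have s1 : (curv (prolongMat G T) i k y * prolongMat G T m y) j p = - (1 / ((n : ℝ) - 1)) *
        ((if j = i then 1 else 0) * ∑ b, tensorq G T y k b * prolongMat G T m y b p
        - (if j = k then 1 else 0) * ∑ b, tensorq G T y i b * prolongMat G T m y b p) := by
      rw [Matrix.mul_apply, Finset.mul_sum, Finset.mul_sum, ← Finset.sum_sub_distrib,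
        Finset.mul_sum]
      exact Finset.sum_congr rfl fun b _ => by rw [hF y hy]; ring
    have s2 : (prolongMat G T m y * curv (prolongMat G T) i k y) j p = - (1 / ((n : ℝ) - 1)) *
        (prolongMat G T m y j i * tensorq G T y k p
          - prolongMat G T m y j k * tensorq G T y i p) := by
      have e : ∀ i, prolongMat G T m y j i
          = ∑ b, prolongMat G T m y j b * (if b = i then 1 else 0) := fun i => by simp
      rw [Matrix.mul_apply, e i, e k, Finset.sum_mul, Finset.sum_mul, ← Finset.sum_sub_distrib,
        Finset.mul_sum]
      exact Finset.sum_congr rfl fun b _ => by rw [hF y hy]; ring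
    rw [Matrix.sub_apply, s1, s2]
    ring
  have hB := congrFun₂ (curv_bianchi h.isOpen sA hy j k l) j p
  rw [Matrix.add_apply, Matrix.add_apply, Matrix.add_apply, Matrix.add_apply, comm, comm, comm,
    hq k l hjk, hq', h0, if_pos rfl, if_neg hjk, if_neg hjl] at hB
  rw [h.cubicTerm_sub hy, Finset.sum_sub_distrib]
  have t1 := h.prolongMat_linear hy (hI y hy) j j k
  have t2 := h.prolongMat_linear hy (hI y hy) j j l
  have t3 := h.prolongMat_linear hy (hI y hy) j k l
  rw [if_pos rfl, if_neg hjk] at t1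
  rw [if_pos rfl, if_neg hjl] at t2
  rw [if_neg hjk, if_neg hjl] at t3
  apply mul_left_cancel₀ (one_div_ne_zero h1)
  linear_combination (-1) * hB + 1 / ((n : ℝ) - 1) * (t1 * tensorq G T y l p
    - t2 * tensorq G T y k p + t3 * tensorq G T y j p)

end IsSmoothMetric

end Cubic

/-! ### The metric in a chart -/

section Chart

variable {n : ℕ} {M : Type*} [TopologicalSpace M] [ChartedSpace (Coord n) M]
  {e : OpenPartialHomeomorph M (Coord n)}

/-- The coordinate vectors of a chart are linearly independent. -/
lemma coordVec_sum_ne_zero (he : e ∈ IsManifold.maximalAtlas (𝓡 n) ∞ M) {y : Coord n}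
    (hy : y ∈ e.target) {v : Fin n → ℝ} (hv : v ≠ 0) : ∑ i, v i • coordVec e y i ≠ 0 := by
  have h1 := (contMDiffOn_symm_of_mem_maximalAtlas he).mdifferentiableOn (by simp)
  have h2 := (contMDiffOn_of_mem_maximalAtlas he).mdifferentiableOn (by simp)
  have hd : e.MDifferentiable (𝓡 n) (𝓡 n) := ⟨h2, h1⟩
  have hinj : Function.Injective (mfderiv (𝓡 n) (𝓡 n) e.symm y) := hd.symm.mfderiv_injective hy
  intro h0
  have h3 : mfderiv (𝓡 n) (𝓡 n) e.symm y
      (∑ i, v i • (EuclideanSpace.single i 1 : Coord n) : Coord n) = 0 := by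
    refine (map_sum (mfderiv (𝓡 n) (𝓡 n) e.symm y)
      (fun i => (v i • EuclideanSpace.single i 1 : Coord n)) Finset.univ).trans
      ((Finset.sum_congr rfl fun i _ => ?_).trans h0)
    exact map_smul (mfderiv (𝓡 n) (𝓡 n) e.symm y) (v i) (EuclideanSpace.single i 1 : Coord n)
  have h4 : (∑ i, v i • (EuclideanSpace.single i 1 : Coord n) : Coord n) = 0 :=
    hinj (h3.trans (map_zero _).symm)
  apply hv
  funext i
  simpa [Pi.single_apply] using congrArg (fun w : Coord n => w i) h4

variable [IsManifold (𝓡 n) ∞ M]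
  (g : ContMDiffRiemannianMetric (𝓡 n) ∞ (Coord n) (fun x : M => TangentSpace (𝓡 n) x))

lemma contMDiffOn_coordVec (he : e ∈ IsManifold.maximalAtlas (𝓡 n) ∞ M) (i : Fin n) :
    ContMDiffOn (𝓡 n) (𝓡 n).tangent ∞
      (fun y => (TotalSpace.mk' (Coord n) (e.symm y) (coordVec e y i) : TangentBundle (𝓡 n) M))
      e.target := by
  have h1 := contMDiffOn_symm_of_mem_maximalAtlas he
  have h2 := h1.contMDiffOn_tangentMapWithin (m := ∞) (by simp) e.open_target.uniqueMDiffOn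
  have h3 : ContMDiffOn (𝓡 n) (𝓡 n).tangent ∞ (fun y : Coord n =>
      (TotalSpace.mk' (Coord n) y (EuclideanSpace.single i 1 : Coord n) :
        TangentBundle (𝓡 n) (Coord n))) e.target :=
    contMDiffOn_vectorSpace_iff_contDiffOn.2 contDiffOn_const
  refine (h2.comp h3 fun y hy => hy).congr fun y hy => ?_
  simp only [Function.comp_apply, tangentMapWithin, coordVec]
  rw [mfderivWithin_of_isOpen e.open_target hy]

lemma smoothMatrix_metricComp (he : e ∈ IsManifold.maximalAtlas (𝓡 n) ∞ M) :
    SmoothMatrix e.target (metricComp g e) := by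
  intro i j
  rw [← contMDiffOn_iff_contDiffOn]
  intro y hy
  have hb := (contMDiffOn_symm_of_mem_maximalAtlas he) y hy
  have hg := (g.contMDiff.contMDiffAt (x := e.symm y)).comp_contMDiffWithinAt y hb
  have h := ContMDiffWithinAt.clm_bundle_apply₂ (F₁ := Coord n) (F₂ := Coord n) (F₃ := ℝ)
    (E₃ := Bundle.Trivial M ℝ) (b := e.symm) (ψ := fun y => g.inner (e.symm y))
    hg (contMDiffOn_coordVec he i y hy) (contMDiffOn_coordVec he j y hy)
  simp only [contMDiffWithinAt_totalSpace] at h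
  exact h.2

lemma isSmoothMetric_metricComp (he : e ∈ IsManifold.maximalAtlas (𝓡 n) ∞ M) :
    IsSmoothMetric e.target (metricComp g e) where
  isOpen := e.open_target
  smooth := smoothMatrix_metricComp g he
  symm := fun y _ i j => g.symm _ _ _
  det := fun y hy => by
    rw [isUnit_iff_ne_zero]
    intro h0
    -- a kernel vector of `(g_{ij})` would be a nonzero tangent vector of length zero
    obtain ⟨v, hv, hGv⟩ := Matrix.exists_mulVec_eq_zero_iff.2 h0
    have hpos := g.pos (e.symm y) _ (coordVec_sum_ne_zero he hy hv)
    have hz : g.inner (e.symm y) (∑ i, v i • coordVec e y i) (∑ j, v j • coordVec e y j)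
        = ∑ i, v i * (metricComp g e y).mulVec v i := by
      simp only [map_sum, map_smul, sum_apply, smul_apply,
        smul_eq_mul, Matrix.mulVec, dotProduct, metricComp, Matrix.of_apply]
      refine Finset.sum_congr rfl fun i _ => congrArg (v i * ·) (Finset.sum_congr rfl fun j _ => ?_)
      rw [g.symm, mul_comm]
    rw [hz, hGv] at hpos
    simp at hpos

end Chart

end SIC

end

theorem mainTheorem5 (n : ℕ) (hn : 3 ≤ n)
    {M : Type*} [TopologicalSpace M] [ChartedSpace (SIC.Coord n) M] [IsManifold (𝓡 n) ∞ M]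
    (g : ContMDiffRiemannianMetric (𝓡 n) ∞ (SIC.Coord n) (fun x : M => TangentSpace (𝓡 n) x))
    (T : SIC.TensorField3 n M) (hT : SIC.IsSmoothTensorField3 T)
    (hsym : SIC.HoldsOn SIC.StructureSymmetriesAt g T) :
    ((SIC.HoldsOn SIC.LinearConditionAt g T ∧ SIC.HoldsOn SIC.QuadraticConditionAt g T ∧
        SIC.HoldsOn SIC.CubicConditionAt g T) ↔
      (SIC.HoldsOn SIC.HookConditionAt g T ∧ SIC.HoldsOn SIC.WeylConditionAt g T ∧
        SIC.HoldsOn SIC.DifferentialConditionAt g T)) ∧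
    (SIC.HoldsOn SIC.LinearConditionAt g T ∧ SIC.HoldsOn SIC.QuadraticConditionAt g T →
      SIC.HoldsOn SIC.CubicConditionAt g T) := by
  have hlin : ∀ e ∈ IsManifold.maximalAtlas (𝓡 n) ∞ M, ∀ y ∈ e.target,
      (SIC.LinearConditionAt (SIC.metricComp g e) (SIC.tensorComp T e) y ↔
        SIC.HookConditionAt (SIC.metricComp g e) (SIC.tensorComp T e) y) := fun e he y hy =>
    SIC.linearConditionAt_iff hn ((SIC.isSmoothMetric_metricComp g he).isMetric hy)
      (hsym e he y hy)
  have hquad : SIC.HoldsOn SIC.LinearConditionAt g T →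
      ∀ e ∈ IsManifold.maximalAtlas (𝓡 n) ∞ M, ∀ y ∈ e.target,
      (SIC.QuadraticConditionAt (SIC.metricComp g e) (SIC.tensorComp T e) y ↔
        SIC.WeylConditionAt (SIC.metricComp g e) (SIC.tensorComp T e) y ∧
        SIC.DifferentialConditionAt (SIC.metricComp g e) (SIC.tensorComp T e) y) :=
    fun hI e he y hy => (SIC.isSmoothMetric_metricComp g he).quadraticConditionAt_iff hn (hT e he)
      (hsym e he) (hI e he) hy
  have hcub : SIC.HoldsOn SIC.LinearConditionAt g T ∧ SIC.HoldsOn SIC.QuadraticConditionAt g T →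
      SIC.HoldsOn SIC.CubicConditionAt g T := fun ⟨hI, hII⟩ e he y hy =>
    (SIC.isSmoothMetric_metricComp g he).cubicConditionAt hn (hT e he) (hI e he) (hII e he) hy
  refine ⟨⟨fun ⟨hI, hII, _⟩ => ?_, fun ⟨h1, h2, h3⟩ => ?_⟩, hcub⟩
  · exact ⟨fun e he y hy => (hlin e he y hy).1 (hI e he y hy),
      fun e he y hy => ((hquad hI e he y hy).1 (hII e he y hy)).1,
      fun e he y hy => ((hquad hI e he y hy).1 (hII e he y hy)).2⟩
  · have hI : SIC.HoldsOn SIC.LinearConditionAt g T := fun e he y hy =>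
      (hlin e he y hy).2 (h1 e he y hy)
    have hII : SIC.HoldsOn SIC.QuadraticConditionAt g T := fun e he y hy =>
      (hquad hI e he y hy).2 ⟨h2 e he y hy, h3 e he y hy⟩
    exact ⟨hI, hII, hcub ⟨hI, hII⟩⟩
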